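/- For a finite simple graph $H$ with vertex set $W$, let $\mathcal P_H\subset\mathbb R^W$ be its symmetric edge polytope, i.e. the convex hull of $\{\pm(\mathbf e_i-\mathbf e_j) : \{i,j\}\in E(H)\}$, and let $N(\mathcal P_H)$ be its number of facets. The $1$-sum of two graphs with exactly one common vertex is their union; the $1$-sum of several graphs is obtained by successive $1$-sums. Let $n\ge 2$, let $G$ be a simple graph on $n-1$ vertices, and let $\widehat G=K_1+G$ be its suspension, obtained from $G$ by adding one new vertex adjacent to all vertices of $G$. **(Lower bound.)** $N(\mathcal P_{\widehat G})\ge 2^{n-1}$. Equality holds if and only if $G$ has no edges, equivalently, if and only if $\widehat G$ is isomorphic to the star $K_{1,n-1}$. **(Upper bound.)** $N(\mathcal P_{\widehat G})\le 6^{(n-1)/2}$ if $n$ is odd, and $N(\mathcal P_{\widehat G})\le 14\cdot 6^{n/2-2}$ if $n$ is even. Equality holds if and only if one of the following holds: (a) $n$ is odd and $G$ is a disjoint union of $(n-1)/2$ edges; equivalently, $n$ is odd and $\widehat G$ is a $1$-sum of $(n-1)/2$ triangles; (b) $n\ge 4$ is even and $G$ is a disjoint union of $n/2-2$ edges and one triangle;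 equivalently, $n\ge 4$ is even and $\widehat G$ is a $1$-sum of $K_4$ with $n/2-2$ triangles. (In particular, for $n=2$ the upper bound is strict.) **(The Braun–Bruegge conjecture for suspension graphs.)** Consequently, if $n\ge 3$, then: - if $n$ is odd, $3\cdot 2^{(n-1)/2}-2\le N(\mathcal P_{\widehat G})\le 6^{(n-1)/2}$, where the left inequality is an equality if and only if $\widehat G\cong K_{(n-1)/2,(n+1)/2}$, and the right one if and only if $\widehat G$ is a $1$-sum of $(n-1)/2$ triangles; - if $n$ is even, $2^{n/2+1}-2\le N(\mathcal P_{\widehat G})\le 14\cdot 6^{n/2-2}$, where the left inequality is an equality if and only if $\widehat G\cong K_{n/2,n/2}$, and the right one if and only if $\widehat G$ is a $1$-sum of $K_4$ with $n/2-2$ triangles. -/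

import Mathlib

/-- The symmetric edge polytope of `G`: the convex hull in `ℝ^V` of the points
`± (e_i - e_j)` with `{i, j}` an edge of `G` (both signs occur because adjacency is symmetric). -/
def symmetricEdgePolytope {V : Type*} [DecidableEq V] (G : SimpleGraph V) : Set (V → ℝ) :=
  convexHull ℝ {x | ∃ i j : V, G.Adj i j ∧ x = Pi.single i (1 : ℝ) - Pi.single j (1 : ℝ)}

/-- `F` is a facet of `P`: a nonempty face of `P` (the set of points of `P` where some linear
functional attains its maximum over `P`) whose dimension is `dim P - 1`. -/
def IsFacet {E : Type*} [AddCommGroup E] [Module ℝ E] [TopologicalSpace E]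
    (P F : Set E) : Prop :=
  IsExposed ℝ P F ∧ F.Nonempty ∧
    Module.finrank ℝ (vectorSpan ℝ F) + 1 = Module.finrank ℝ (vectorSpan ℝ P)

/-- `N(P_G)`, the number of facets of the symmetric edge polytope of `G`. -/
noncomputable def numFacets {V : Type*} [DecidableEq V] (G : SimpleGraph V) : ℕ :=
  {F : Set (V → ℝ) | IsFacet (symmetricEdgePolytope G) F}.ncard

/-- The suspension of `G`: a new vertex `none` is joined to every vertex of `G`. -/
def suspension {V : Type*} (G : SimpleGraph V) : SimpleGraph (Option V) where
  Adj a b :=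
    match a, b with
    | none, none => False
    | none, some _ => True
    | some _, none => True
    | some v, some w => G.Adj v w
  symm := ⟨by
    rintro (_ | v) (_ | w) h
    · exact h
    · trivial
    · trivial
    · exact G.adj_symm h⟩
  loopless := ⟨by
    rintro (_ | v) h
    · exact h
    · exact G.irrefl h⟩

/-- The disjoint union of `k` edges, on the `2 * k` vertices `Fin k × Fin 2`. -/
def disjointEdges (k : ℕ) : SimpleGraph (Fin k × Fin 2) where
  Adj a b := a.1 = b.1 ∧ a.2 ≠ b.2
  symm := ⟨fun _ _ h => ⟨h.1.symm, h.2.symm⟩⟩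
  loopless := ⟨fun _ h => h.2 rfl⟩

/-- `IsOneSum S H`: the subgraph `H` is obtained from the multiset `S` of subgraphs by successive
1-sums, where a 1-sum is the union of two graphs with exactly one common vertex. -/
inductive IsOneSum {V : Type*} {G : SimpleGraph V} : Multiset G.Subgraph → G.Subgraph → Prop
  | single (H : G.Subgraph) : IsOneSum {H} H
  | glue {S T : Multiset G.Subgraph} {A B : G.Subgraph} (hA : IsOneSum S A) (hB : IsOneSum T B)
      (h : ∃ v : V, A.verts ∩ B.verts = {v}) : IsOneSum (S + T) (A ⊔ B)

/-- The subgraph `H` is a copy of the complete graph `K_m`. -/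
def IsCompleteCopy {V : Type*} {G : SimpleGraph V} (m : ℕ) (H : G.Subgraph) : Prop :=
  Nonempty (H.coe ≃g (⊤ : SimpleGraph (Fin m)))

/-- `G` is a 1-sum of `k` triangles. -/
def IsOneSumOfTriangles {V : Type*} (G : SimpleGraph V) (k : ℕ) : Prop :=
  ∃ S : Multiset G.Subgraph, S.card = k ∧ (∀ H ∈ S, IsCompleteCopy 3 H) ∧ IsOneSum S ⊤

/-- `G` is a 1-sum of one `K_4` and `k` triangles. -/
def IsOneSumOfK4AndTriangles {V : Type*} (G : SimpleGraph V) (k : ℕ) : Prop :=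
  ∃ (Q : G.Subgraph) (S : Multiset G.Subgraph), IsCompleteCopy 4 Q ∧ S.card = k ∧
    (∀ H ∈ S, IsCompleteCopy 3 H) ∧ IsOneSum (Q ::ₘ S) ⊤

/-- The assertion of the Braun–Bruegge conjecture for a single graph `G` with `n` vertices
(the conjecture says that it holds for every connected graph with `n ≥ 3` vertices). -/
def SatisfiesBraunBruegge {V : Type*} [Fintype V] [DecidableEq V] (G : SimpleGraph V) : Prop :=
  let n : ℕ := Fintype.card V
  let N : ℝ := numFacets G
  (Odd n →
    3 * (2 : ℝ) ^ (((n : ℝ) - 1) / 2) - 2 ≤ N ∧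
    N ≤ (6 : ℝ) ^ (((n : ℝ) - 1) / 2) ∧
    (N = 3 * (2 : ℝ) ^ (((n : ℝ) - 1) / 2) - 2 ↔
      Nonempty (G ≃g completeBipartiteGraph (Fin ((n - 1) / 2)) (Fin ((n + 1) / 2)))) ∧
    (N = (6 : ℝ) ^ (((n : ℝ) - 1) / 2) ↔ IsOneSumOfTriangles G ((n - 1) / 2))) ∧
  (Even n →
    (2 : ℝ) ^ ((n : ℝ) / 2 + 1) - 2 ≤ N ∧
    N ≤ 14 * (6 : ℝ) ^ ((n : ℝ) / 2 - 2) ∧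
    (N = (2 : ℝ) ^ ((n : ℝ) / 2 + 1) - 2 ↔
      Nonempty (G ≃g completeBipartiteGraph (Fin (n / 2)) (Fin (n / 2)))) ∧
    (N = 14 * (6 : ℝ) ^ ((n : ℝ) / 2 - 2) ↔ IsOneSumOfK4AndTriangles G (n / 2 - 2)))

/-! A facet of the symmetric edge polytope of the suspension is cut out by a functional with
positive maximum. Normalised to maximum 1, it is a potential that is 0 at the apex and changes by at
most 1 along every edge. It defines a facet exactly when the tight edges (difference 1) span the
same space as all edges. Spanning forces the values to lie in {-1, 0, 1} and every vertex of value 0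
to have a neighbour of nonzero value; conversely these conditions suffice. Hence the facets are
counted by the labelings of `G` (`numFacets_suspension`), and the theorem becomes a counting problem
on `G`.

Upper bound. Prescribing the labels on a set `X` leaves at most as many labelings as the graph
without `X` has (`card_labelings_prescribed_le`). Prescribed zeros can simply be forgotten. A vertex
`x` with label `s ≠ 0` is erased by giving `-s` to the vertices that only `x` dominated; this is
injective because a neighbour of `x` could not have carried `-s` before. So deleting `X` costs at
most a factor equal to the number of states on `X`. A longest path yields (`exists_reduction`) an
isolated vertex (2 states), a leaf with its neighbour (6), a triangle with two vertices of degree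
two (14), or a cycle of length at least four (closed walks in the graph of compatible signs).
Against the growth by 6 for every two vertices, only the leaf and the triangle can be sharp. They
are sharp only as connected components: otherwise the erasing injection misses a labeling
(`card_labelings_fiber_lt`). Since 14² < 6³, at most one triangle occurs.

Lower bound. Every vertex set `A` gives a labeling with value 1 exactly on `A`, and any edge of `G`
allows one more labeling.

For the 1-sums, the apex is adjacent to everything, so it must be the gluing vertex at every stage.
Decompositions of the suspension therefore mirror the components of `G`. The Braun–Bruegge bounds
follow by comparing with 2^(n-1); a suspension that is complete bipartite is a star, which leaves
only n = 3 for equality on the left. -/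

/-- A labeling of `G[Y]` by signs, extended by zero: adjacent vertices never carry opposite signs
and every vertex of `Y` with label zero has a neighbour with nonzero label. -/
structure IsLabeling {V : Type*} (G : SimpleGraph V) (Y : Finset V) (f : V → SignType) : Prop where
  eq_zero : ∀ v, v ∉ Y → f v = 0
  mul_ne : ∀ u v, G.Adj u v → f u * f v ≠ -1
  dominated : ∀ v ∈ Y, f v = 0 → ∃ w, G.Adj v w ∧ f w ≠ 0

open Classical in
/-- The finset of all labelings of `G[Y]`. -/
noncomputable def labelings {V : Type*} [Fintype V] (G : SimpleGraph V) (Y : Finset V) :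
    Finset (V → SignType) :=
  Finset.univ.filter (IsLabeling G Y)

/-! ### Labelings with prescribed values on a subset -/

section Fibers

variable {V : Type*} {G : SimpleGraph V} {Y : Finset V}

theorem mem_labelings [Fintype V] {f : V → SignType} :
    f ∈ labelings G Y ↔ IsLabeling G Y f := by
  simp [labelings]

theorem SignType.mul_self_ne_neg_one : ∀ s : SignType, s * s ≠ -1 := by decide

theorem SignType.ne_of_mul_ne : ∀ s t : SignType, s ≠ 0 → s * t ≠ -1 → t ≠ -s := by decide

open Classical in
/-- Remove the vertex `x` with label `s` from a labeling, giving the label `-s` to those vertices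
that were dominated by `x` only. -/
noncomputable def eraseVertex (G : SimpleGraph V) (Y : Finset V) (x : V) (s : SignType)
    (f : V → SignType) (v : V) : SignType :=
  if v = x then 0
  else if v ∈ Y ∧ f v = 0 ∧ ∀ w, G.Adj v w → w ≠ x → f w = 0 then -s else f v

theorem eraseVertex_of_ne_zero {x v : V} {s : SignType} {f : V → SignType} (hv : v ≠ x)
    (hf : f v ≠ 0) : eraseVertex G Y x s f v = f v := by
  simp [eraseVertex, hv, hf]

/-- Relabelled vertices had label 0 and, apart from `x`, only neighbours of label 0, so giving all
of them the same sign creates no conflict. Any vertex that stays 0 has a nonzero neighbour other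
than `x`. -/
theorem IsLabeling.eraseVertex [DecidableEq V] {x : V} {s : SignType} {f : V → SignType}
    (hf : IsLabeling G Y f) (hs : s ≠ 0) :
    IsLabeling G (Y.erase x) (eraseVertex G Y x s f) where
  eq_zero v hv := by
    by_cases hx : v = x
    · simp [_root_.eraseVertex, hx]
    · have hY : v ∉ Y := fun h => hv (Finset.mem_erase.2 ⟨hx, h⟩)
      simp [_root_.eraseVertex, hY, hf.eq_zero v hY]
  mul_ne u v huv := by
    unfold _root_.eraseVertex
    by_cases hu : u = x
    · simp [hu]
    by_cases hv : v = x
    · simp [hv]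
    rw [if_neg hu, if_neg hv]
    split_ifs with h1 h2 h2
    · exact SignType.mul_self_ne_neg_one _
    · simp [h1.2.2 v huv hv]
    · simp [h2.2.2 u huv.symm hu]
    · exact hf.mul_ne u v huv
  dominated v hv h := by
    rw [Finset.mem_erase] at hv
    unfold _root_.eraseVertex at h
    rw [if_neg hv.1] at h
    split_ifs at h with h1
    · exact absurd (by simpa using h) hs
    · push Not at h1
      obtain ⟨w, hw, hwx, hw0⟩ := h1 hv.2 h
      exact ⟨w, hw, by rwa [eraseVertex_of_ne_zero hwx hw0]⟩

/-- If `v` is relabelled in `f` but not in `g`, then `g v = -s`. But `v` was dominated in `f` by `x`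
alone, hence is adjacent to `x`, and `g x = s` forbids this. -/
theorem eraseVertex_apply_eq {x v : V} {s : SignType} {f g : V → SignType}
    (hf : IsLabeling G Y f) (hg : IsLabeling G Y g) (hs : s ≠ 0) (hgx : g x = s)
    (hvx : v ≠ x) (h : eraseVertex G Y x s f v = eraseVertex G Y x s g v)
    (hv : v ∈ Y ∧ f v = 0 ∧ ∀ w, G.Adj v w → w ≠ x → f w = 0) : f v = g v := by
  unfold eraseVertex at h
  rw [if_neg hvx, if_neg hvx, if_pos hv] at h
  split_ifs at h with h1
  · rw [hv.2.1, h1.2.1]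
  · obtain ⟨w, hw, hw0⟩ := hf.dominated v hv.1 hv.2.1
    have hwx : w = x := by
      by_contra hne
      exact hw0 (hv.2.2 w hw hne)
    subst hwx
    exact absurd h.symm (SignType.ne_of_mul_ne _ _ hs (hgx ▸ hg.mul_ne _ _ hw.symm))

theorem eraseVertex_injOn {x : V} {s : SignType} (hs : s ≠ 0) :
    Set.InjOn (eraseVertex G Y x s) {f | IsLabeling G Y f ∧ f x = s} := by
  rintro f ⟨hf, hfx⟩ g ⟨hg, hgx⟩ h
  ext1 v
  by_cases hvx : v = x
  · rw [hvx, hfx, hgx]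
  have hv := congrFun h v
  by_cases h1 : v ∈ Y ∧ f v = 0 ∧ ∀ w, G.Adj v w → w ≠ x → f w = 0
  · exact eraseVertex_apply_eq hf hg hs hgx hvx hv h1
  by_cases h2 : v ∈ Y ∧ g v = 0 ∧ ∀ w, G.Adj v w → w ≠ x → g w = 0
  · exact (eraseVertex_apply_eq hg hf hs hfx hvx hv.symm h2).symm
  · simpa [eraseVertex, hvx, h1, h2] using hv

variable [DecidableEq V]

theorem IsLabeling.sdiff {f : V → SignType} (hf : IsLabeling G Y f) {Z : Finset V}
    (hZ : ∀ z ∈ Z, f z = 0) : IsLabeling G (Y \ Z) f where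
  eq_zero v hv := by
    by_cases h : v ∈ Z
    · exact hZ v h
    · exact hf.eq_zero v fun hY => hv (Finset.mem_sdiff.2 ⟨hY, h⟩)
  mul_ne := hf.mul_ne
  dominated v hv := hf.dominated v (Finset.mem_sdiff.1 hv).1

variable [Fintype V]

/-- The vertices of `X` are erased one at a time. Erasing changes only labels equal to 0, so the
nonzero prescriptions on the rest of `X` survive. -/
theorem card_labelings_prescribed_le_of_ne_zero (τ : V → SignType) (X : Finset V) :
    ∀ Y : Finset V, X ⊆ Y → (∀ x ∈ X, τ x ≠ 0) →
      ((labelings G Y).filter fun f => ∀ x ∈ X, f x = τ x).card ≤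
        (labelings G (Y \ X)).card := by
  induction X using Finset.induction_on with
  | empty => intro Y _ _; simp
  | insert x X hx ih =>
    intro Y hXY hτ
    have hX : X ⊆ Y.erase x := fun v hv =>
      Finset.mem_erase.2 ⟨fun h => hx (h ▸ hv), hXY (Finset.mem_insert_of_mem hv)⟩
    have key := ih (Y.erase x) hX fun v hv => hτ v (Finset.mem_insert_of_mem hv)
    have hset : Y.erase x \ X = Y \ insert x X := by ext; simp; tauto
    rw [hset] at key
    refine le_trans (Finset.card_le_card_of_injOn (eraseVertex G Y x (τ x)) ?_ ?_) key
    · intro f hf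
      simp only [Finset.coe_filter, Set.mem_ofPred_eq, mem_labelings, Finset.mem_insert,
        forall_eq_or_imp] at hf ⊢
      refine ⟨hf.1.eraseVertex (hτ x (Finset.mem_insert_self _ _)), fun v hv => ?_⟩
      rw [eraseVertex_of_ne_zero (ne_of_mem_of_not_mem hv hx), hf.2.2 v hv]
      rw [hf.2.2 v hv]
      exact hτ v (Finset.mem_insert_of_mem hv)
    · refine (eraseVertex_injOn (hτ x (Finset.mem_insert_self _ _))).mono ?_
      intro f hf
      simp only [Finset.coe_filter, Set.mem_ofPred_eq, mem_labelings, Finset.mem_insert,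
        forall_eq_or_imp] at hf
      exact ⟨hf.1, hf.2.1⟩

/-- Prescribing the labels on `X` leaves at most as many labelings as there are on `Y \ X`. -/
theorem card_labelings_prescribed_le (τ : V → SignType) {X : Finset V} (hX : X ⊆ Y) :
    ((labelings G Y).filter fun f => ∀ x ∈ X, f x = τ x).card ≤ (labelings G (Y \ X)).card := by
  -- Vertices prescribed to be 0 dominate nothing, so they can be dropped without relabelling; only
  -- `X \ Z` needs erasing.
  set Z := X.filter fun x => τ x = 0 with hZ
  have h := card_labelings_prescribed_le_of_ne_zero (G := G) τ (X \ Z) (Y \ Z)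
    (Finset.sdiff_subset_sdiff hX le_rfl) (by
      intro x hx
      simp only [hZ, Finset.mem_sdiff, Finset.mem_filter, not_and] at hx
      exact hx.2 hx.1)
  have hset : (Y \ Z) \ (X \ Z) = Y \ X := by
    ext v; simp only [Finset.mem_sdiff, hZ, Finset.mem_filter]; tauto
  rw [hset] at h
  refine le_trans (Finset.card_le_card fun f hf => ?_) h
  simp only [Finset.mem_filter, mem_labelings] at hf ⊢
  refine ⟨hf.1.sdiff fun z hz => ?_, fun x hx => hf.2 x (Finset.mem_sdiff.1 hx).1⟩
  rw [hZ, Finset.mem_filter] at hz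
  rw [hf.2 z hz.1, hz.2]

/-- Erasing `x` misses the labeling that is 0 on the neighbours of `t` and `-s` elsewhere. In a
preimage `f`, the vertex `t` next to `x` cannot carry `-s`, so it was relabelled and all its
neighbours except `x` have label 0. Then `w` has label 0 and was not relabelled, so it needs a
nonzero neighbour `z ≠ x`; but `z` is `t` or adjacent to `t`. -/
theorem card_labelings_fiber_lt {x t w : V} {s : SignType} (hs : s ≠ 0)
    (ht : t ∈ Y.erase x) (hxt : G.Adj x t) (hw : w ∈ Y.erase x) (htw : G.Adj t w)
    (hN : ∀ z ∈ Y.erase x, G.Adj w z → z = t ∨ G.Adj t z) :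
    ((labelings G Y).filter fun f => f x = s).card < (labelings G (Y.erase x)).card := by
  classical
  set g : V → SignType := fun v => if v ∈ Y.erase x ∧ ¬ G.Adj t v then -s else 0 with hg
  have hgL : IsLabeling G (Y.erase x) g := by
    refine ⟨fun v hv => by simp only [hg, hv, false_and, if_false], fun u v _ => ?_,
      fun v hv h0 => ?_⟩
    · simp only [hg]
      split_ifs <;> simp [SignType.mul_self_ne_neg_one]
    · have hvt : G.Adj t v := by
        by_contra hne
        simp only [hg, hv, hne, not_false_eq_true, and_self, if_true] at h0
        exact hs (by simpa using h0)
      refine ⟨t, hvt.symm, ?_⟩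
      simp only [hg, ht, G.irrefl, not_false_eq_true, and_self, if_true]
      exact fun h => hs (by simpa using h)
  rw [← Finset.card_image_of_injOn (s := (labelings G Y).filter fun f => f x = s)
    (f := eraseVertex G Y x s) ((eraseVertex_injOn hs).mono (by
      intro f hf
      simpa only [Finset.coe_filter, Set.mem_ofPred_eq, mem_labelings] using hf))]
  refine Finset.card_lt_card ?_
  rw [Finset.ssubset_iff_of_subset]
  · refine ⟨g, mem_labelings.2 hgL, fun hmem => ?_⟩
    simp only [Finset.mem_image, Finset.mem_filter, mem_labelings] at hmem
    obtain ⟨f, ⟨hf, hfx⟩, hfg⟩ := hmem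
    have htx := (Finset.mem_erase.1 ht).1
    have hwx := (Finset.mem_erase.1 hw).1
    have hgt := congrFun hfg t
    have hgw := congrFun hfg w
    simp only [hg, ht, hw, htw, G.irrefl, not_false_eq_true, and_self, if_true, not_true,
      and_false, if_false, eraseVertex, htx, hwx] at hgt hgw
    have htmod : t ∈ Y ∧ f t = 0 ∧ ∀ w, G.Adj t w → w ≠ x → f w = 0 := by
      by_contra hne
      rw [if_neg hne] at hgt
      exact SignType.ne_of_mul_ne _ _ hs (hfx ▸ hf.mul_ne _ _ hxt) hgt
    split_ifs at hgw with hwmod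
    · exact hs (by simpa using hgw)
    · push Not at hwmod
      obtain ⟨z, hwz, hzx, hz⟩ := hwmod (Finset.mem_erase.1 hw).2 hgw
      have hzY : z ∈ Y.erase x := by
        refine Finset.mem_erase.2 ⟨hzx, ?_⟩
        by_contra hzY
        exact hz (hf.eq_zero z hzY)
      rcases hN z hzY hwz with rfl | htz
      · exact hz htmod.2.1
      · exact hz (htmod.2.2 z htz hzx)
  · intro f hf
    simp only [Finset.mem_image, Finset.mem_filter, mem_labelings] at hf ⊢
    obtain ⟨f, ⟨hf, -⟩, rfl⟩ := hf
    exact hf.eraseVertex hs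

/-- Prescribing a nonzero label at `x` and zero labels on `Z` leaves strictly fewer labelings than
there are on the remaining vertices, if `x` has a suitable neighbour `t` among these. -/
theorem card_labelings_prescribed_lt (τ : V → SignType) {x t w : V} {Z : Finset V}
    (hτx : τ x ≠ 0) (hτ : ∀ z ∈ Z, τ z = 0)
    (ht : t ∈ Y \ insert x Z) (hxt : G.Adj x t) (hw : w ∈ Y \ insert x Z) (htw : G.Adj t w)
    (hN : ∀ z ∈ Y \ insert x Z, G.Adj w z → z = t ∨ G.Adj t z) :
    ((labelings G Y).filter fun f => ∀ v ∈ insert x Z, f v = τ v).card <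
      (labelings G (Y \ insert x Z)).card := by
  have hset : Y \ insert x Z = (Y \ Z).erase x := by ext; simp; tauto
  rw [hset] at ht hw hN ⊢
  refine lt_of_le_of_lt (Finset.card_le_card fun f hf => ?_)
    (card_labelings_fiber_lt hτx ht hxt hw htw hN)
  simp only [Finset.mem_filter, mem_labelings, Finset.mem_insert, forall_eq_or_imp] at hf ⊢
  exact ⟨hf.1.sdiff fun z hz => (hf.2.2 z hz).trans (hτ z hz), hf.2.1⟩

theorem card_labelings_fiberwise_le {α : Type*} [DecidableEq α] {X : Finset V} (hX : X ⊆ Y)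
    (π : (V → SignType) → α) (hπ : ∀ f g, π f = π g → ∀ x ∈ X, f x = g x) (a : α) :
    ((labelings G Y).filter fun f => π f = a).card ≤ (labelings G (Y \ X)).card := by
  rcases ((labelings G Y).filter fun f => π f = a).eq_empty_or_nonempty with h | ⟨g, hg⟩
  · simp [h]
  · refine le_trans (Finset.card_le_card fun f hf => ?_) (card_labelings_prescribed_le g hX)
    rw [Finset.mem_filter] at hf hg ⊢
    exact ⟨hf.1, hπ f g (hf.2.trans hg.2.symm)⟩

/-- If the labelings restricted to `X` take at most `|A|` states, then removing `X` decreases the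
number of labelings at most by the factor `|A|`. -/
theorem card_labelings_le_mul {α : Type*} [DecidableEq α] {X : Finset V} (hX : X ⊆ Y)
    (π : (V → SignType) → α) (hπ : ∀ f g, π f = π g → ∀ x ∈ X, f x = g x) (A : Finset α)
    (hA : ∀ f, IsLabeling G Y f → π f ∈ A) :
    (labelings G Y).card ≤ A.card * (labelings G (Y \ X)).card := by
  rw [mul_comm]
  exact Finset.card_le_mul_card_image_of_maps_to (fun f hf => hA f (mem_labelings.1 hf)) _
    fun a _ => card_labelings_fiberwise_le hX π hπ a

theorem card_labelings_lt_mul {α : Type*} [DecidableEq α] {X : Finset V} (hX : X ⊆ Y)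
    (π : (V → SignType) → α) (hπ : ∀ f g, π f = π g → ∀ x ∈ X, f x = g x) (A : Finset α)
    (hA : ∀ f, IsLabeling G Y f → π f ∈ A) {a : α} (ha : a ∈ A)
    (hlt : ((labelings G Y).filter fun f => π f = a).card < (labelings G (Y \ X)).card) :
    (labelings G Y).card < A.card * (labelings G (Y \ X)).card := by
  rw [Finset.card_eq_sum_card_fiberwise (f := π) (t := A)
    (fun f hf => hA f (mem_labelings.1 hf)), ← smul_eq_mul, ← Finset.sum_const]
  exact Finset.sum_lt_sum (fun a _ => card_labelings_fiberwise_le hX π hπ a) ⟨a, ha, hlt⟩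

end Fibers

/-! ### The extremal function and its growth -/

/-- Six times the maximal number of labelings of a graph with `m` vertices. -/
def labelingBound : ℕ → ℕ
  | 0 => 6
  -- One vertex has only 2 labelings, so 14 (rather than 12) is not attained here. It is the value
  -- that makes the recursion give 6 · 14 for three vertices, where a triangle is optimal.
  | 1 => 14
  | m + 2 => 6 * labelingBound m

theorem labelingBound_pos : ∀ m, 0 < labelingBound m
  | 0 => by decide
  | 1 => by decide
  | m + 2 => by have := labelingBound_pos m; simp only [labelingBound]; omega

theorem labelingBound_even (k : ℕ) : labelingBound (2 * k) = 6 ^ (k + 1) := by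
  induction k with
  | zero => rfl
  | succ k ih => rw [Nat.mul_succ, labelingBound, ih]; ring

theorem labelingBound_odd (k : ℕ) : labelingBound (2 * k + 1) = 14 * 6 ^ k := by
  induction k with
  | zero => rfl
  | succ k ih => rw [show 2 * (k + 1) + 1 = (2 * k + 1) + 2 by ring, labelingBound, ih]; ring

/-- Consecutive ratios alternate between 14/6 = 7/3 and 36/14 > 7/3. This beats the factor 2 of an
isolated vertex and is just enough for a 5-cycle. -/
theorem seven_mul_labelingBound_le : ∀ m, 7 * labelingBound m ≤ 3 * labelingBound (m + 1)
  | 0 => by decide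
  | 1 => by decide
  | m + 2 => by have := seven_mul_labelingBound_le m; simp only [labelingBound] at this ⊢; omega

/-- For even `m` a triangle is worth exactly its share of the bound; for odd `m` it is not, since 14
· 14 < 6 · 36. The parity clause is what later excludes two triangles. -/
theorem fourteen_mul_labelingBound : ∀ m, 14 * labelingBound m ≤ labelingBound (m + 3) ∧
    (14 * labelingBound m = labelingBound (m + 3) → Even m)
  | 0 => by decide
  | 1 => by decide
  | m + 2 => by
    have := fourteen_mul_labelingBound m
    rw [labelingBound, show m + 2 + 3 = (m + 3) + 2 by ring, labelingBound]
    exact ⟨by omega, fun h => (this.2 (by omega)).add even_two⟩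

/-! ### Closed walks of compatible signs, for long cycles -/

/-- The number of walks with `k` steps from `a` to `b` in the graph of compatible signs. -/
def numSignWalks : ℕ → SignType → SignType → ℕ
  | 0, a, b => if a = b then 1 else 0
  | k + 1, a, b => ∑ c with a * c ≠ -1, numSignWalks k c b

/-- The walks with `k` steps from `a` to `b` in the graph of compatible signs. -/
def signWalks : ℕ → SignType → SignType → Finset (List SignType)
  | 0, a, b => if a = b then {[a]} else ∅
  | k + 1, a, b =>
    (Finset.univ.filter fun c => a * c ≠ -1).biUnion fun c => (signWalks k c b).image (List.cons a)

theorem card_signWalks_le (k : ℕ) : ∀ a b, (signWalks k a b).card ≤ numSignWalks k a b := by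
  induction k with
  | zero => intro a b; simp only [signWalks, numSignWalks]; split_ifs <;> simp
  | succ k ih =>
    intro a b
    exact Finset.card_biUnion_le.trans
      (Finset.sum_le_sum fun c _ => Finset.card_image_le.trans (ih c b))

theorem mem_signWalks (l : List SignType) : ∀ a, (a :: l).IsChain (fun s t => s * t ≠ -1) →
    a :: l ∈ signWalks l.length a ((a :: l).getLast (by simp)) := by
  induction l with
  | nil => intro a _; simp [signWalks]
  | cons c l ih =>
    intro a h
    rw [List.isChain_cons_cons] at h
    simp only [signWalks, List.length_cons, Finset.mem_biUnion, Finset.mem_filter,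
      Finset.mem_univ, true_and, Finset.mem_image]
    exact ⟨c, h.1, c :: l, by rw [List.getLast_cons (by simp)]; exact ih c h.2, rfl⟩

/-- The number of closed walks with `k + 1` steps in the graph of compatible signs. -/
def numClosedSignWalks (k : ℕ) : ℕ :=
  ∑ ab : SignType × SignType with ab.2 * ab.1 ≠ -1, numSignWalks k ab.1 ab.2

theorem numSignWalks_succ (k : ℕ) (b : SignType) :
    numSignWalks (k + 1) 0 b = numSignWalks k 0 b + numSignWalks k 1 b + numSignWalks k (-1) b ∧
    numSignWalks (k + 1) 1 b = numSignWalks k 0 b + numSignWalks k 1 b ∧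
    numSignWalks (k + 1) (-1) b = numSignWalks k 0 b + numSignWalks k (-1) b := by
  have h0 : (Finset.univ.filter fun c : SignType => 0 * c ≠ -1) = {0, 1, -1} := by decide
  have h1 : (Finset.univ.filter fun c : SignType => 1 * c ≠ -1) = {0, 1} := by decide
  have h2 : (Finset.univ.filter fun c : SignType => -1 * c ≠ -1) = {0, -1} := by decide
  refine ⟨?_, ?_, ?_⟩ <;> simp only [numSignWalks, h0, h1, h2]
  · rw [Finset.sum_insert (by decide), Finset.sum_insert (by decide), Finset.sum_singleton,
      add_assoc]
  · rw [Finset.sum_insert (by decide), Finset.sum_singleton]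
  · rw [Finset.sum_insert (by decide), Finset.sum_singleton]

/-- The numbers of walks with `k` steps between given signs, in terms of `z`, `p` and `q`. -/
structure HasSignWalkCounts (k z p q : ℕ) : Prop where
  zero_zero : numSignWalks k 0 0 = z
  zero_one : numSignWalks k 0 1 = p
  zero_neg : numSignWalks k 0 (-1) = p
  one_zero : numSignWalks k 1 0 = p
  neg_zero : numSignWalks k (-1) 0 = p
  one_one : numSignWalks k 1 1 = q + 1
  neg_neg : numSignWalks k (-1) (-1) = q + 1
  one_neg : numSignWalks k 1 (-1) = q
  neg_one : numSignWalks k (-1) 1 = q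
  -- This relation closes the recursion: the count from 0 to 1 becomes p + (q + 1) + q, which is z +
  -- p.
  eq_two_mul : z = 2 * q + 1

theorem HasSignWalkCounts.succ {k z p q : ℕ} (h : HasSignWalkCounts k z p q) :
    HasSignWalkCounts (k + 1) (z + 2 * p) (z + p) (q + p) := by
  obtain ⟨h1, h2, h3, h4, h5, h6, h7, h8, h9, h10⟩ := h
  obtain ⟨a1, a2, a3⟩ := numSignWalks_succ k 0
  obtain ⟨b1, b2, b3⟩ := numSignWalks_succ k 1
  obtain ⟨c1, c2, c3⟩ := numSignWalks_succ k (-1)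
  rw [h1, h4, h5] at a1
  rw [h1, h4] at a2
  rw [h1, h5] at a3
  rw [h2, h6, h9] at b1
  rw [h2, h6] at b2
  rw [h2, h9] at b3
  rw [h3, h8, h7] at c1
  rw [h3, h8] at c2
  rw [h3, h7] at c3
  constructor <;> omega

theorem exists_hasSignWalkCounts (k : ℕ) :
    ∃ z p q, HasSignWalkCounts k z p q ∧ (1 ≤ k → z ≤ 2 * p) := by
  induction k with
  | zero => exact ⟨1, 0, 0, by constructor <;> decide, by simp⟩
  | succ k ih =>
    obtain ⟨z, p, q, h, -⟩ := ih
    exact ⟨_, _, _, h.succ, by omega⟩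

theorem HasSignWalkCounts.numClosedSignWalks_eq {k z p q : ℕ} (hk : HasSignWalkCounts k z p q) :
    numClosedSignWalks k = 2 * z + 4 * p + 1 := by
  have h : (Finset.univ.filter fun ab : SignType × SignType => ab.2 * ab.1 ≠ -1) =
      {(0, 0), (0, 1), (0, -1), (1, 0), (-1, 0), (1, 1), (-1, -1)} := by decide
  rw [numClosedSignWalks, h]
  repeat rw [Finset.sum_insert (by decide)]
  rw [Finset.sum_singleton, hk.zero_zero, hk.zero_one, hk.zero_neg, hk.one_zero, hk.neg_zero,
    hk.one_one, hk.neg_neg, hk.eq_two_mul]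
  ring

/-- The largest eigenvalue of the compatibility graph is 1 + √2, whose square 3 + 2√2 is below 6. In
terms of the counts, 14z + 20p + 1 is compared with 6(2z + 4p + 1) using z ≤ 2p. -/
theorem numClosedSignWalks_add_two_le (k : ℕ) (hk : 1 ≤ k) :
    numClosedSignWalks (k + 2) ≤ 6 * numClosedSignWalks k := by
  obtain ⟨z, p, q, h, hle⟩ := exists_hasSignWalkCounts k
  have := hle hk
  rw [h.numClosedSignWalks_eq, h.succ.succ.numClosedSignWalks_eq]
  omega

/-- A cycle of length at least four is never optimal. The base cases are tight: 35 < 36 for the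
4-cycle, and 83 < 84 = 36 · 7/3 for the 5-cycle. Two further vertices cost at most a factor 6. -/
theorem numClosedSignWalks_mul_labelingBound_lt (k j : ℕ) :
    numClosedSignWalks (k + 3) * labelingBound j < labelingBound (j + (k + 4)) := by
  induction k using Nat.twoStepInduction with
  | zero =>
    have h : numClosedSignWalks 3 = 35 := by decide +kernel
    have := labelingBound_pos j
    rw [Nat.zero_add, h, Nat.zero_add, show j + 4 = (j + 2) + 2 by ring, labelingBound,
      labelingBound]
    omega
  | one =>
    have h : numClosedSignWalks (1 + 3) = 83 := by decide +kernel
    have := labelingBound_pos j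
    have := seven_mul_labelingBound_le j
    rw [h, show j + (1 + 4) = (j + 1 + 2) + 2 by ring, labelingBound, labelingBound]
    omega
  | more k ih _ =>
    have h := numClosedSignWalks_add_two_le (k + 3) (by omega)
    rw [show j + (k + 2 + 4) = (j + (k + 4)) + 2 by ring, labelingBound,
      show k + 2 + 3 = k + 3 + 2 by ring]
    calc _ ≤ 6 * numClosedSignWalks (k + 3) * labelingBound j := Nat.mul_le_mul_right _ h
      _ < _ := by rw [mul_assoc]; omega

/-! ### Reduction inequalities for the four local configurations -/

/-- The pairs of compatible signs that are not both zero. -/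
def edgeStates : Finset (SignType × SignType) :=
  Finset.univ.filter fun s => s.1 * s.2 ≠ -1 ∧ (s.1 ≠ 0 ∨ s.2 ≠ 0)

/-- The triples of pairwise compatible signs that are not all zero. -/
def triangleStates : Finset (SignType × SignType × SignType) :=
  Finset.univ.filter fun s => s.1 * s.2.1 ≠ -1 ∧ s.1 * s.2.2 ≠ -1 ∧ s.2.1 * s.2.2 ≠ -1 ∧
    (s.1 ≠ 0 ∨ s.2.1 ≠ 0 ∨ s.2.2 ≠ 0)

theorem card_edgeStates : edgeStates.card = 6 := by decide +kernel

theorem card_triangleStates : triangleStates.card = 14 := by decide +kernel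

section Reductions

variable {V : Type*} {G : SimpleGraph V} {Y : Finset V}

/-- The state (0, 0) is excluded because `v` is the only vertex that can dominate the leaf `u`. -/
theorem mem_edgeStates {u v : V} (hu : u ∈ Y) (huv : G.Adj u v)
    (hN : ∀ w ∈ Y, G.Adj u w → w = v) {f : V → SignType} (hf : IsLabeling G Y f) :
    (f u, f v) ∈ edgeStates := by
  simp only [edgeStates, Finset.mem_filter, Finset.mem_univ, true_and]
  refine ⟨hf.mul_ne u v huv, ?_⟩
  by_contra! h
  obtain ⟨w, hw, hw0⟩ := hf.dominated u hu h.1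
  have hwY : w ∈ Y := by
    by_contra hwY
    exact hw0 (hf.eq_zero w hwY)
  rw [hN w hwY hw] at hw0
  exact hw0 h.2

theorem mem_triangleStates {a b c : V} (ha : a ∈ Y) (hab : G.Adj a b) (hac : G.Adj a c)
    (hbc : G.Adj b c) (hN : ∀ w ∈ Y, G.Adj a w → w = b ∨ w = c) {f : V → SignType}
    (hf : IsLabeling G Y f) : (f a, f b, f c) ∈ triangleStates := by
  simp only [triangleStates, Finset.mem_filter, Finset.mem_univ, true_and]
  refine ⟨hf.mul_ne _ _ hab, hf.mul_ne _ _ hac, hf.mul_ne _ _ hbc, ?_⟩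
  by_contra! h
  obtain ⟨w, hw, hw0⟩ := hf.dominated a ha h.1
  have hwY : w ∈ Y := by
    by_contra hwY
    exact hw0 (hf.eq_zero w hwY)
  rcases hN w hwY hw with rfl | rfl
  · exact hw0 h.2.1
  · exact hw0 h.2.2

variable [Fintype V] [DecidableEq V]

theorem card_labelings_le_of_isolated {v : V} (hv : v ∈ Y) (h : ∀ w ∈ Y, ¬ G.Adj v w) :
    (labelings G Y).card ≤ 2 * (labelings G (Y \ {v})).card := by
  refine card_labelings_le_mul (A := {1, -1}) (Finset.singleton_subset_iff.2 hv) (fun f => f v)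
    (fun f g hfg x hx => by rw [Finset.mem_singleton.1 hx]; exact hfg) ?_
  intro f hf
  have h0 : f v ≠ 0 := by
    intro h0
    obtain ⟨w, hw, hw0⟩ := hf.dominated v hv h0
    exact hw0 (hf.eq_zero w fun hY => h w hY hw)
  rcases SignType.trichotomy (f v) with h | h | h <;> simp_all

theorem card_labelings_le_of_leaf {u v : V} (hu : u ∈ Y) (hv : v ∈ Y) (huv : G.Adj u v)
    (hN : ∀ w ∈ Y, G.Adj u w → w = v) :
    (labelings G Y).card ≤ 6 * (labelings G (Y \ {v, u})).card := by
  rw [← card_edgeStates]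
  refine card_labelings_le_mul (by simp [Finset.insert_subset_iff, hu, hv])
    (fun f => (f u, f v)) (fun f g hfg x hx => ?_) _ fun f hf => mem_edgeStates hu huv hN hf
  simp only [Prod.mk.injEq, Finset.mem_insert, Finset.mem_singleton] at hfg hx
  rcases hx with rfl | rfl
  exacts [hfg.2, hfg.1]

/-- The loss occurs in the state with `u` labelled 0 and `v` labelled 1: forgetting `u` and erasing
`v` is not surjective when `v` has a neighbour `t` outside the pair. -/
theorem card_labelings_lt_of_leaf {u v t w : V} (hu : u ∈ Y) (hv : v ∈ Y) (huv : G.Adj u v)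
    (hN : ∀ w ∈ Y, G.Adj u w → w = v) (ht : t ∈ Y \ {v, u}) (hvt : G.Adj v t)
    (hw : w ∈ Y \ {v, u}) (htw : G.Adj t w)
    (hwN : ∀ z ∈ Y \ {v, u}, G.Adj w z → z = t ∨ G.Adj t z) :
    (labelings G Y).card < 6 * (labelings G (Y \ {v, u})).card := by
  rw [← card_edgeStates]
  refine card_labelings_lt_mul (by simp [Finset.insert_subset_iff, hu, hv])
    (fun f => (f u, f v)) (fun f g hfg x hx => ?_) _ (fun f hf => mem_edgeStates hu huv hN hf)
    (a := (0, 1)) (by decide) ?_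
  · simp only [Prod.mk.injEq, Finset.mem_insert, Finset.mem_singleton] at hfg hx
    rcases hx with rfl | rfl
    exacts [hfg.2, hfg.1]
  · refine lt_of_le_of_lt (Finset.card_le_card fun f hf => ?_)
      (card_labelings_prescribed_lt (τ := fun x => if x = v then 1 else 0)
        (by simp) (by simp [huv.ne]) ht hvt hw htw hwN)
    simp only [Finset.mem_filter, Prod.mk.injEq] at hf ⊢
    simp [hf, huv.ne]

theorem card_labelings_le_of_triangle {a b c : V} (ha : a ∈ Y) (hb : b ∈ Y) (hc : c ∈ Y)
    (hab : G.Adj a b) (hac : G.Adj a c) (hbc : G.Adj b c)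
    (hN : ∀ w ∈ Y, G.Adj a w → w = b ∨ w = c) :
    (labelings G Y).card ≤ 14 * (labelings G (Y \ {c, a, b})).card := by
  rw [← card_triangleStates]
  refine card_labelings_le_mul (by simp [Finset.insert_subset_iff, ha, hb, hc])
    (fun f => (f a, f b, f c)) (fun f g hfg x hx => ?_) _
    fun f hf => mem_triangleStates ha hab hac hbc hN hf
  simp only [Prod.mk.injEq, Finset.mem_insert, Finset.mem_singleton] at hfg hx
  rcases hx with rfl | rfl | rfl
  exacts [hfg.2.2, hfg.1, hfg.2.1]

/-- As for the leaf, with the loss in the state (0, 0, 1): `a` and `b` are forgotten, and `c`, which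
has the outside neighbour `t`, is erased. -/
theorem card_labelings_lt_of_triangle {a b c t w : V} (ha : a ∈ Y) (hb : b ∈ Y) (hc : c ∈ Y)
    (hab : G.Adj a b) (hac : G.Adj a c) (hbc : G.Adj b c)
    (hN : ∀ w ∈ Y, G.Adj a w → w = b ∨ w = c) (ht : t ∈ Y \ {c, a, b}) (hct : G.Adj c t)
    (hw : w ∈ Y \ {c, a, b}) (htw : G.Adj t w)
    (hwN : ∀ z ∈ Y \ {c, a, b}, G.Adj w z → z = t ∨ G.Adj t z) :
    (labelings G Y).card < 14 * (labelings G (Y \ {c, a, b})).card := by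
  rw [← card_triangleStates]
  refine card_labelings_lt_mul (by simp [Finset.insert_subset_iff, ha, hb, hc])
    (fun f => (f a, f b, f c)) (fun f g hfg x hx => ?_) _
    (fun f hf => mem_triangleStates ha hab hac hbc hN hf) (a := (0, 0, 1)) (by decide) ?_
  · simp only [Prod.mk.injEq, Finset.mem_insert, Finset.mem_singleton] at hfg hx
    rcases hx with rfl | rfl | rfl
    exacts [hfg.2.2, hfg.1, hfg.2.1]
  · refine lt_of_le_of_lt (Finset.card_le_card fun f hf => ?_)
      (card_labelings_prescribed_lt (τ := fun x => if x = c then 1 else 0)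
        (by simp) (by simp [hac.ne, hbc.ne]) ht hct hw htw hwN)
    simp only [Finset.mem_filter, Prod.mk.injEq] at hf ⊢
    simp [hf, hac.ne, hbc.ne]

/-- Reading the labels around the cycle gives a walk of `l.length` steps, and the closing edge makes
its endpoints compatible. Domination is not used, so the all-zero state is counted too. -/
theorem card_labelings_le_of_cycle {x : V} {l : List V} (hY : ∀ v ∈ x :: l, v ∈ Y)
    (hl : (x :: l).IsChain G.Adj) (hx : G.Adj ((x :: l).getLast (by simp)) x) :
    (labelings G Y).card ≤
      numClosedSignWalks l.length * (labelings G (Y \ (x :: l).toFinset)).card := by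
  have key := card_labelings_le_mul (G := G) (Y := Y) (X := (x :: l).toFinset)
    (fun v hv => hY v (List.mem_toFinset.1 hv)) (fun f => (x :: l).map f)
    (fun f g hfg v hv => List.map_inj_left.1 hfg v (List.mem_toFinset.1 hv))
    ((Finset.univ.filter fun ab : SignType × SignType => ab.2 * ab.1 ≠ -1).biUnion
      fun ab => signWalks l.length ab.1 ab.2) ?_
  · exact key.trans (Nat.mul_le_mul_right _ (Finset.card_biUnion_le.trans
      (Finset.sum_le_sum fun ab _ => card_signWalks_le _ _ _)))
  · intro f hf
    simp only [Finset.mem_biUnion, Finset.mem_filter, Finset.mem_univ, true_and]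
    refine ⟨(f x, f ((x :: l).getLast (by simp))), hf.mul_ne _ _ hx, ?_⟩
    have hchain : ((x :: l).map f).IsChain fun s t => s * t ≠ -1 := by
      rw [List.isChain_map]
      exact hl.imp fun u v huv => hf.mul_ne u v huv
    have := mem_signWalks (l.map f) (f x) (by simpa using hchain)
    simpa [List.getLast_map, ← List.map_cons] using this

end Reductions

/-! ### Longest paths and the extremal graphs -/

section Structure

variable {V : Type*}

/-- The list `p` is a path of `G` inside `Y`. -/
structure IsListPath (G : SimpleGraph V) (Y : Finset V) (p : List V) : Prop where
  nodup : p.Nodup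
  subset : ∀ v ∈ p, v ∈ Y
  isChain : p.IsChain G.Adj

/-- A cycle of `G` inside `Y` of length at least four, as the list `x :: l` of its vertices. -/
structure IsLongCycle (G : SimpleGraph V) (Y : Finset V) (x : V) (l : List V) : Prop where
  three_le : 3 ≤ l.length
  nodup : (x :: l).Nodup
  subset : ∀ v ∈ x :: l, v ∈ Y
  isChain : (x :: l).IsChain G.Adj
  closed : G.Adj ((x :: l).getLast (by simp)) x

variable {G : SimpleGraph V} {Y : Finset V}

theorem exists_longest_listPath (hY : Y.Nonempty) : ∃ p : List V, p ≠ [] ∧ IsListPath G Y p ∧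
    ∀ q, IsListPath G Y q → q.length ≤ p.length := by
  classical
  have hbound : ∀ q, IsListPath G Y q → q.length ≤ Y.card := fun q hq => by
    rw [← List.toFinset_card_of_nodup hq.nodup]
    exact Finset.card_le_card fun v hv => hq.subset v (List.mem_toFinset.1 hv)
  obtain ⟨v, hv⟩ := hY
  have h1 : IsListPath G Y [v] := ⟨by simp, by simpa using hv, by simp⟩
  set Q : ℕ → Prop := fun n => ∃ p, IsListPath G Y p ∧ p.length = n with hQ
  have hspec : Q (Nat.findGreatest Q Y.card) :=
    Nat.findGreatest_spec (hbound _ h1) ⟨[v], h1, rfl⟩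
  obtain ⟨p, hp, hlen⟩ := hspec
  have hmax : ∀ q, IsListPath G Y q → q.length ≤ p.length := fun q hq => by
    rw [hlen]
    exact Nat.le_findGreatest (hbound q hq) ⟨q, hq, rfl⟩
  refine ⟨p, ?_, hp, hmax⟩
  rintro rfl
  simpa using hmax [v] h1

theorem mem_of_adj_head {x : V} {p : List V} (hp : IsListPath G Y (x :: p))
    (hmax : ∀ q, IsListPath G Y q → q.length ≤ (x :: p).length) {w : V} (hw : w ∈ Y)
    (hxw : G.Adj x w) : w ∈ p := by
  by_contra hwp
  have := hmax (w :: x :: p)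
    ⟨List.nodup_cons.2 ⟨by simp [hwp, hxw.ne'], hp.nodup⟩,
      by simpa [hw] using hp.subset, by simpa [hxw.symm] using hp.isChain⟩
  simp at this

/-- By maximality every neighbour of the head lies on the path. One beyond the third vertex would
close a cycle of length at least four. -/
theorem eq_or_eq_of_adj_head {x y z : V} {t : List V} (hp : IsListPath G Y (x :: y :: z :: t))
    (hmax : ∀ q, IsListPath G Y q → q.length ≤ (x :: y :: z :: t).length)
    (hcyc : ∀ x l, ¬ IsLongCycle G Y x l) {w : V} (hw : w ∈ Y) (hxw : G.Adj x w) :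
    w = y ∨ w = z := by
  by_contra! hne
  have hmem := mem_of_adj_head hp hmax hw hxw
  simp only [List.mem_cons, hne.1, hne.2, false_or] at hmem
  obtain ⟨l₁, l₂, rfl⟩ := List.append_of_mem hmem
  have happ : x :: y :: z :: (l₁ ++ w :: l₂) = (x :: y :: z :: (l₁ ++ [w])) ++ l₂ := by simp
  obtain ⟨h1, h2, h3⟩ := hp
  rw [happ] at h1 h2 h3
  refine hcyc x (y :: z :: (l₁ ++ [w])) ⟨by simp, (List.nodup_append.1 h1).1,
    fun v hv => h2 v (List.mem_append_left _ hv), h3.left_of_append, ?_⟩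
  have hlast : (x :: y :: z :: (l₁ ++ [w])).getLast (by simp) = w := by
    simp
  rw [hlast]
  exact hxw.symm

/-- Every nonempty graph has an isolated vertex, a leaf, a triangle with two vertices of degree
two, or a cycle of length at least four. -/
theorem exists_reduction (G : SimpleGraph V) (hY : Y.Nonempty) :
    (∃ v ∈ Y, ∀ w ∈ Y, ¬ G.Adj v w) ∨
    (∃ u ∈ Y, ∃ v ∈ Y, G.Adj u v ∧ ∀ w ∈ Y, G.Adj u w → w = v) ∨
    (∃ a ∈ Y, ∃ b ∈ Y, ∃ c ∈ Y, G.Adj a b ∧ G.Adj a c ∧ G.Adj b c ∧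
      (∀ w ∈ Y, G.Adj a w → w = b ∨ w = c) ∧ ∀ w ∈ Y, G.Adj b w → w = a ∨ w = c) ∨
    ∃ x l, IsLongCycle G Y x l := by
  by_contra! h
  obtain ⟨h1, h2, h3, h4⟩ := h
  obtain ⟨p, hp0, hp, hmax⟩ := exists_longest_listPath (G := G) hY
  obtain ⟨x, p, rfl⟩ := List.exists_cons_of_ne_nil hp0
  have hxY := hp.subset x (by simp)
  obtain ⟨w, hwY, hw⟩ := h1 x hxY
  have hwp := mem_of_adj_head hp hmax hwY hw
  obtain ⟨y, p, rfl⟩ := List.exists_cons_of_ne_nil (List.ne_nil_of_mem hwp)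
  have hyY := hp.subset y (by simp)
  have hxy : G.Adj x y := (List.isChain_cons_cons.1 hp.isChain).1
  obtain ⟨w, hwY, hw, hwy⟩ := h2 x hxY y hyY hxy
  have hwp := mem_of_adj_head hp hmax hwY hw
  rw [List.mem_cons, or_iff_right hwy] at hwp
  obtain ⟨z, t, rfl⟩ := List.exists_cons_of_ne_nil (List.ne_nil_of_mem hwp)
  have hzY := hp.subset z (by simp)
  have hN : ∀ w ∈ Y, G.Adj x w → w = y ∨ w = z := fun w hw hxw =>
    eq_or_eq_of_adj_head hp hmax h4 hw hxw
  have hxz : G.Adj x z := by rwa [← (hN w hwY hw).resolve_left hwy]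
  have hyz : G.Adj y z := (List.isChain_cons_cons.1 (List.isChain_cons_cons.1 hp.isChain).2).1
  -- As `x` is adjacent to `z`, swapping the first two vertices gives another longest path, so the
  -- neighbours of `y` are restricted in the same way.
  have hp' : IsListPath G Y (y :: x :: z :: t) := by
    obtain ⟨a, b, c⟩ := hp
    refine ⟨?_, ?_, ?_⟩
    · simp only [List.nodup_cons, List.mem_cons, not_or] at a ⊢
      exact ⟨⟨Ne.symm a.1.1, a.2.1⟩, ⟨a.1.2, a.2.2⟩⟩
    · intro v hv
      refine b v ?_
      simp only [List.mem_cons] at hv ⊢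
      tauto
    · simp only [List.isChain_cons_cons] at c ⊢
      exact ⟨hxy.symm, hxz, c.2.2⟩
  obtain ⟨w, hwY, hw, hwx, hwz⟩ := h3 x hxY y hyY z hzY hxy hxz hyz hN
  rcases eq_or_eq_of_adj_head hp' (by simpa using hmax) h4 hwY hw with h | h
  exacts [hwx h, hwz h]

/-- Every vertex of `Y` has exactly one neighbour in `Y`. -/
def IsMatchingOn (G : SimpleGraph V) (Y : Finset V) : Prop :=
  ∀ v ∈ Y, ∃ w ∈ Y, G.Adj v w ∧ ∀ z ∈ Y, G.Adj v z → z = w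

/-- The vertices `a`, `b`, `c` form a triangle that is a connected component of `G[Y]`. -/
structure IsIsolatedTriangle (G : SimpleGraph V) (Y : Finset V) (a b c : V) : Prop where
  mem₁ : a ∈ Y
  mem₂ : b ∈ Y
  mem₃ : c ∈ Y
  adj₁₂ : G.Adj a b
  adj₁₃ : G.Adj a c
  adj₂₃ : G.Adj b c
  nbr₁ : ∀ w ∈ Y, G.Adj a w → w = b ∨ w = c
  nbr₂ : ∀ w ∈ Y, G.Adj b w → w = a ∨ w = c
  nbr₃ : ∀ w ∈ Y, G.Adj c w → w = a ∨ w = b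

/-- This supplies the vertex `w` required by the strict reductions: any attachment to an extremal
remainder loses labelings. -/
theorem IsMatchingOn.exists_nbr (h : IsMatchingOn G Y) {t : V} (ht : t ∈ Y) :
    ∃ w ∈ Y, G.Adj t w ∧ ∀ z ∈ Y, G.Adj w z → z = t ∨ G.Adj t z := by
  obtain ⟨w, hw, htw, -⟩ := h t ht
  obtain ⟨t', -, -, ht'⟩ := h w hw
  refine ⟨w, hw, htw, fun z hz hwz => Or.inl ?_⟩
  rw [ht' z hz hwz, ht' t ht htw.symm]

variable [DecidableEq V]

/-- `G[Y]` is the disjoint union of a triangle and a perfect matching. -/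
def IsMatchingWithTriangleOn (G : SimpleGraph V) (Y : Finset V) : Prop :=
  ∃ a b c, IsIsolatedTriangle G Y a b c ∧ IsMatchingOn G (Y \ {c, a, b})

theorem IsMatchingWithTriangleOn.exists_nbr (h : IsMatchingWithTriangleOn G Y) {t : V}
    (ht : t ∈ Y) : ∃ w ∈ Y, G.Adj t w ∧ ∀ z ∈ Y, G.Adj w z → z = t ∨ G.Adj t z := by
  obtain ⟨a, b, c, hT, hM⟩ := h
  by_cases h : t ∈ Y \ {c, a, b}
  · obtain ⟨w, hw, htw, hN⟩ := hM.exists_nbr h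
    refine ⟨w, (Finset.mem_sdiff.1 hw).1, htw, fun z hz hwz => ?_⟩
    by_cases hz' : z ∈ Y \ {c, a, b}
    · exact hN z hz' hwz
    · simp only [Finset.mem_sdiff, hz, true_and, not_not, Finset.mem_insert,
        Finset.mem_singleton] at hz'
      simp only [Finset.mem_sdiff, Finset.mem_insert, Finset.mem_singleton, not_or] at hw
      rcases hz' with rfl | rfl | rfl
      · rcases hT.nbr₃ w hw.1 hwz.symm with h | h <;> simp [h] at hw
      · rcases hT.nbr₁ w hw.1 hwz.symm with h | h <;> simp [h] at hw
      · rcases hT.nbr₂ w hw.1 hwz.symm with h | h <;> simp [h] at hw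
  · simp only [Finset.mem_sdiff, ht, true_and, not_not, Finset.mem_insert,
        Finset.mem_singleton] at h
    rcases h with rfl | rfl | rfl
    · refine ⟨a, hT.mem₁, hT.adj₁₃.symm, fun z hz haz => ?_⟩
      rcases hT.nbr₁ z hz haz with rfl | rfl
      exacts [Or.inr hT.adj₂₃.symm, Or.inl rfl]
    · refine ⟨b, hT.mem₂, hT.adj₁₂, fun z hz haz => ?_⟩
      rcases hT.nbr₂ z hz haz with rfl | rfl
      exacts [Or.inl rfl, Or.inr hT.adj₁₃]
    · refine ⟨a, hT.mem₁, hT.adj₁₂.symm, fun z hz haz => ?_⟩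
      rcases hT.nbr₁ z hz haz with rfl | rfl
      exacts [Or.inl rfl, Or.inr hT.adj₂₃]

/-- Adding an isolated edge to a perfect matching. -/
theorem IsMatchingOn.of_sdiff {u v : V} (hu : u ∈ Y) (hv : v ∈ Y) (huv : G.Adj u v)
    (hNu : ∀ w ∈ Y, G.Adj u w → w = v) (hNv : ∀ w ∈ Y, G.Adj v w → w = u)
    (h : IsMatchingOn G (Y \ {v, u})) : IsMatchingOn G Y := by
  intro x hx
  by_cases hxv : x = v
  · subst hxv; exact ⟨u, hu, huv.symm, hNv⟩
  by_cases hxu : x = u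
  · subst hxu; exact ⟨v, hv, huv, hNu⟩
  obtain ⟨w, hw, hxw, hN⟩ := h x (by simp [hx, hxv, hxu])
  refine ⟨w, (Finset.mem_sdiff.1 hw).1, hxw, fun z hz hxz => hN z ?_ hxz⟩
  simp only [Finset.mem_sdiff, hz, true_and, Finset.mem_insert, Finset.mem_singleton, not_or]
  constructor
  · rintro rfl; exact hxu (hNv x hx hxz.symm)
  · rintro rfl; exact hxv (hNu x hx hxz.symm)

theorem IsMatchingOn.sdiff {u v : V} (hu : u ∈ Y) (hv : v ∈ Y) (huv : G.Adj u v)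
    (h : IsMatchingOn G Y) : (∀ w ∈ Y, G.Adj u w → w = v) ∧ (∀ w ∈ Y, G.Adj v w → w = u) ∧
      IsMatchingOn G (Y \ {v, u}) := by
  have hNu : ∀ w ∈ Y, G.Adj u w → w = v := by
    obtain ⟨w, -, -, hw⟩ := h u hu
    intro z hz huz
    rw [hw z hz huz, hw v hv huv]
  have hNv : ∀ w ∈ Y, G.Adj v w → w = u := by
    obtain ⟨w, -, -, hw⟩ := h v hv
    intro z hz huz
    rw [hw z hz huz, hw u hu huv.symm]
  refine ⟨hNu, hNv, fun x hx => ?_⟩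
  simp only [Finset.mem_sdiff, Finset.mem_insert, Finset.mem_singleton, not_or] at hx
  obtain ⟨w, hw, hxw, hN⟩ := h x hx.1
  refine ⟨w, ?_, hxw, fun z hz => hN z (Finset.mem_sdiff.1 hz).1⟩
  simp only [Finset.mem_sdiff, hw, true_and, Finset.mem_insert, Finset.mem_singleton, not_or]
  constructor
  · rintro rfl; exact hx.2.2 (hNv x hx.1 hxw.symm)
  · rintro rfl; exact hx.2.1 (hNu x hx.1 hxw.symm)

theorem IsMatchingWithTriangleOn.of_sdiff {u v : V} (hu : u ∈ Y) (hv : v ∈ Y) (huv : G.Adj u v)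
    (hNu : ∀ w ∈ Y, G.Adj u w → w = v) (hNv : ∀ w ∈ Y, G.Adj v w → w = u)
    (h : IsMatchingWithTriangleOn G (Y \ {v, u})) : IsMatchingWithTriangleOn G Y := by
  obtain ⟨a, b, c, hT, hM⟩ := h
  have key : ∀ x ∈ Y \ {v, u}, ∀ w ∈ Y, G.Adj x w → w ∈ Y \ {v, u} := by
    intro x hx w hw hxw
    simp only [Finset.mem_sdiff, hw, true_and, Finset.mem_insert, Finset.mem_singleton,
      not_or] at hx ⊢
    constructor
    · rintro rfl; exact hx.2.2 (hNv x hx.1 hxw.symm)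
    · rintro rfl; exact hx.2.1 (hNu x hx.1 hxw.symm)
  have hne : ∀ x ∈ Y \ {v, u}, x ∈ Y ∧ v ≠ x ∧ u ≠ x := by
    intro x hx
    simp only [Finset.mem_sdiff, Finset.mem_insert, Finset.mem_singleton, not_or] at hx
    exact ⟨hx.1, Ne.symm hx.2.1, Ne.symm hx.2.2⟩
  have ha := hne a hT.mem₁
  have hb := hne b hT.mem₂
  have hc := hne c hT.mem₃
  refine ⟨a, b, c, ⟨ha.1, hb.1, hc.1, hT.adj₁₂, hT.adj₁₃, hT.adj₂₃,
    fun w hw h => hT.nbr₁ w (key a hT.mem₁ w hw h) h,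
    fun w hw h => hT.nbr₂ w (key b hT.mem₂ w hw h) h,
    fun w hw h => hT.nbr₃ w (key c hT.mem₃ w hw h) h⟩, ?_⟩
  refine IsMatchingOn.of_sdiff (u := u) (v := v) (by simp [hu, ha, hb, hc])
    (by simp [hv, ha, hb, hc]) huv (fun w hw => hNu w (Finset.mem_sdiff.1 hw).1)
    (fun w hw => hNv w (Finset.mem_sdiff.1 hw).1) ?_
  rwa [sdiff_sdiff_comm]

theorem card_sdiff_pair {u v : V} (hu : u ∈ Y) (hv : v ∈ Y) (huv : G.Adj u v) :
    (Y \ {v, u}).card + 2 = Y.card := by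
  rw [← Finset.card_pair huv.ne']
  exact Finset.card_sdiff_add_card_eq_card (by simp [Finset.insert_subset_iff, hu, hv])

theorem card_sdiff_triple {a b c : V} (ha : a ∈ Y) (hb : b ∈ Y) (hc : c ∈ Y)
    (hab : G.Adj a b) (hac : G.Adj a c) (hbc : G.Adj b c) :
    (Y \ {c, a, b}).card + 3 = Y.card := by
  have h : ({c, a, b} : Finset V).card = 3 := by
    rw [Finset.card_eq_three]
    exact ⟨c, a, b, hac.ne', hbc.ne', hab.ne, rfl⟩
  rw [← h]
  exact Finset.card_sdiff_add_card_eq_card (by simp [Finset.insert_subset_iff, ha, hb, hc])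

end Structure

/-! ### The sharp upper bound for labelings -/

section Extremal

variable {V : Type*} [Fintype V] {G : SimpleGraph V} {Y : Finset V}

theorem card_labelings_empty : (labelings G (∅ : Finset V)).card = 1 := by
  rw [Finset.card_eq_one]
  refine ⟨fun _ => 0, Finset.ext fun f => ?_⟩
  rw [mem_labelings, Finset.mem_singleton]
  refine ⟨fun hf => funext fun v => hf.eq_zero v (by simp), ?_⟩
  rintro rfl
  exact ⟨by simp, by simp, by simp⟩

variable [DecidableEq V]

/-- For an edge that is a component, each of the six states extends every labeling of the rest, so
the leaf reduction is sharp. -/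
theorem six_mul_card_labelings_sdiff_le {u v : V} (hu : u ∈ Y) (hv : v ∈ Y) (huv : G.Adj u v)
    (hNu : ∀ w ∈ Y, G.Adj u w → w = v) (hNv : ∀ w ∈ Y, G.Adj v w → w = u) :
    6 * (labelings G (Y \ {v, u})).card ≤ (labelings G Y).card := by
  rw [← card_edgeStates, ← Finset.card_product]
  set φ : (SignType × SignType) × (V → SignType) → V → SignType := fun s =>
    Function.update (Function.update s.2 u s.1.1) v s.1.2 with hφ
  refine Finset.card_le_card_of_injOn φ ?_ ?_
  · rintro ⟨⟨a, b⟩, g⟩ hs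
    simp only [Finset.coe_product, Set.mem_prod, Finset.mem_coe, mem_labelings, edgeStates,
      Finset.mem_filter, Finset.mem_univ, true_and] at hs ⊢
    obtain ⟨⟨hab, h0⟩, hg⟩ := hs
    have hφu : φ ((a, b), g) u = a := by simp [hφ, huv.ne]
    have hφv : φ ((a, b), g) v = b := by simp [hφ]
    have hφx : ∀ x, x ≠ u → x ≠ v → φ ((a, b), g) x = g x := fun x h1 h2 => by
      simp [hφ, h1, h2]
    have hgu : g u = 0 := hg.eq_zero u (by simp)
    have hgv : g v = 0 := hg.eq_zero v (by simp)
    have hout : ∀ x, x ∉ Y → φ ((a, b), g) x = 0 := by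
      intro x hx
      rw [hφx x (by rintro rfl; exact hx hu) (by rintro rfl; exact hx hv)]
      exact hg.eq_zero x (by simp [hx])
    refine ⟨hout, ?_, ?_⟩
    · intro x y hxy
      by_cases hxY : x ∈ Y
      swap
      · rw [hout x hxY]; simp
      by_cases hyY : y ∈ Y
      swap
      · rw [hout y hyY]; simp
      by_cases hxu : x = u
      · subst hxu
        rw [hNu y hyY hxy, hφu, hφv]; exact hab
      by_cases hxv : x = v
      · subst hxv
        rw [hNv y hyY hxy, hφu, hφv, mul_comm]; exact hab
      by_cases hyu : y = u
      · subst hyu; exact absurd (hNu x hxY hxy.symm) hxv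
      by_cases hyv : y = v
      · subst hyv; exact absurd (hNv x hxY hxy.symm) hxu
      rw [hφx x hxu hxv, hφx y hyu hyv]
      exact hg.mul_ne x y hxy
    · intro x hx hx0
      by_cases hxu : x = u
      · subst hxu
        rw [hφu] at hx0
        exact ⟨v, huv, by rw [hφv]; simpa [hx0] using h0⟩
      by_cases hxv : x = v
      · subst hxv
        rw [hφv] at hx0
        exact ⟨u, huv.symm, by rw [hφu]; simpa [hx0] using h0⟩
      rw [hφx x hxu hxv] at hx0
      obtain ⟨w, hw, hw0⟩ := hg.dominated x (by simp [hx, hxu, hxv]) hx0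
      refine ⟨w, hw, ?_⟩
      rwa [hφx w (by rintro rfl; exact hw0 hgu) (by rintro rfl; exact hw0 hgv)]
  · rintro ⟨⟨a, b⟩, g⟩ hs ⟨⟨a', b'⟩, g'⟩ hs' h
    simp only [Finset.coe_product, Set.mem_prod, Finset.mem_coe, mem_labelings] at hs hs'
    have h1 := congrFun h u
    have h2 := congrFun h v
    simp only [hφ, Function.update_self, Function.update_of_ne huv.ne] at h1 h2
    subst h1 h2
    refine Prod.ext rfl (funext fun x => ?_)
    by_cases hxu : x = u
    · subst hxu; exact (hs.2.eq_zero x (by simp)).trans (hs'.2.eq_zero x (by simp)).symm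
    by_cases hxv : x = v
    · subst hxv; exact (hs.2.eq_zero x (by simp)).trans (hs'.2.eq_zero x (by simp)).symm
    simpa [hφ, hxu, hxv] using congrFun h x

theorem fourteen_mul_card_labelings_sdiff_le {a b c : V} (hT : IsIsolatedTriangle G Y a b c) :
    14 * (labelings G (Y \ {c, a, b})).card ≤ (labelings G Y).card := by
  obtain ⟨ha, hb, hc, hab, hac, hbc, hNa, hNb, hNc⟩ := hT
  rw [← card_triangleStates, ← Finset.card_product]
  set φ : (SignType × SignType × SignType) × (V → SignType) → V → SignType := fun s =>
    Function.update (Function.update (Function.update s.2 a s.1.1) b s.1.2.1) c s.1.2.2 with hφ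
  refine Finset.card_le_card_of_injOn φ ?_ ?_
  · rintro ⟨⟨p, q, r⟩, g⟩ hs
    simp only [Finset.coe_product, Set.mem_prod, Finset.mem_coe, mem_labelings, triangleStates,
      Finset.mem_filter, Finset.mem_univ, true_and] at hs ⊢
    obtain ⟨⟨hpq, hpr, hqr, h0⟩, hg⟩ := hs
    have hφa : φ ((p, q, r), g) a = p := by simp [hφ, hab.ne, hac.ne]
    have hφb : φ ((p, q, r), g) b = q := by simp [hφ, hbc.ne]
    have hφc : φ ((p, q, r), g) c = r := by simp [hφ]
    have hφx : ∀ x, x ≠ a → x ≠ b → x ≠ c → φ ((p, q, r), g) x = g x := fun x h1 h2 h3 => by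
      simp [hφ, h1, h2, h3]
    have hout : ∀ x, x ∉ Y → φ ((p, q, r), g) x = 0 := by
      intro x hx
      rw [hφx x (by rintro rfl; exact hx ha) (by rintro rfl; exact hx hb)
        (by rintro rfl; exact hx hc)]
      exact hg.eq_zero x (by simp [hx])
    refine ⟨hout, ?_, ?_⟩
    · intro x y hxy
      by_cases hxY : x ∈ Y
      swap
      · rw [hout x hxY]; simp
      by_cases hyY : y ∈ Y
      swap
      · rw [hout y hyY]; simp
      by_cases hxa : x = a
      · subst hxa
        rcases hNa y hyY hxy with rfl | rfl <;> simp only [hφa, hφb, hφc] <;> assumption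
      by_cases hxb : x = b
      · subst hxb
        rcases hNb y hyY hxy with rfl | rfl
        · rw [hφa, hφb, mul_comm]; exact hpq
        · rw [hφb, hφc]; exact hqr
      by_cases hxc : x = c
      · subst hxc
        rcases hNc y hyY hxy with rfl | rfl
        · rw [hφa, hφc, mul_comm]; exact hpr
        · rw [hφb, hφc, mul_comm]; exact hqr
      by_cases hya : y = a
      · subst hya
        rcases hNa x hxY hxy.symm with h | h
        exacts [absurd h hxb, absurd h hxc]
      by_cases hyb : y = b
      · subst hyb
        rcases hNb x hxY hxy.symm with h | h
        exacts [absurd h hxa, absurd h hxc]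
      by_cases hyc : y = c
      · subst hyc
        rcases hNc x hxY hxy.symm with h | h
        exacts [absurd h hxa, absurd h hxb]
      rw [hφx x hxa hxb hxc, hφx y hya hyb hyc]
      exact hg.mul_ne x y hxy
    · intro x hx hx0
      by_cases hxa : x = a
      · subst hxa
        rw [hφa] at hx0
        simp only [hx0, ne_eq, not_true, false_or] at h0
        rcases h0 with h | h
        exacts [⟨b, hab, by rwa [hφb]⟩, ⟨c, hac, by rwa [hφc]⟩]
      by_cases hxb : x = b
      · subst hxb
        rw [hφb] at hx0
        simp only [hx0, ne_eq, not_true, false_or] at h0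
        rcases h0 with h | h
        exacts [⟨a, hab.symm, by rwa [hφa]⟩, ⟨c, hbc, by rwa [hφc]⟩]
      by_cases hxc : x = c
      · subst hxc
        rw [hφc] at hx0
        simp only [hx0, ne_eq, not_true, or_false] at h0
        rcases h0 with h | h
        exacts [⟨a, hac.symm, by rwa [hφa]⟩, ⟨b, hbc.symm, by rwa [hφb]⟩]
      rw [hφx x hxa hxb hxc] at hx0
      obtain ⟨w, hw, hw0⟩ := hg.dominated x (by simp [hx, hxa, hxb, hxc]) hx0
      refine ⟨w, hw, ?_⟩
      rwa [hφx w] <;> rintro rfl <;> exact hw0 (hg.eq_zero _ (by simp))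
  · rintro ⟨⟨p, q, r⟩, g⟩ hs ⟨⟨p', q', r'⟩, g'⟩ hs' h
    simp only [Finset.coe_product, Set.mem_prod, Finset.mem_coe, mem_labelings] at hs hs'
    have h1 := congrFun h a
    have h2 := congrFun h b
    have h3 := congrFun h c
    simp only [hφ, Function.update_self, Function.update_of_ne hab.ne,
      Function.update_of_ne hac.ne, Function.update_of_ne hbc.ne] at h1 h2 h3
    subst h1 h2 h3
    refine Prod.ext rfl (funext fun x => ?_)
    by_cases hx : x = a ∨ x = b ∨ x = c
    · exact (hs.2.eq_zero x (by simp; tauto)).trans (hs'.2.eq_zero x (by simp; tauto)).symm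
    · push Not at hx
      simpa [hφ, hx] using congrFun h x

/-- The bound and its equality cases are proved in one strong induction: the extremal shape of the
remainder is needed to see that an attached leaf or triangle loses labelings. The middle claim also
provides the parity of a matching. -/
theorem six_mul_card_labelings_le_and (G : SimpleGraph V) (n : ℕ) : ∀ Y : Finset V, Y.card = n →
    6 * (labelings G Y).card ≤ labelingBound n ∧
    (IsMatchingOn G Y → Even n ∧ 6 * (labelings G Y).card = labelingBound n) ∧
    (6 * (labelings G Y).card = labelingBound n →
      IsMatchingOn G Y ∨ IsMatchingWithTriangleOn G Y) := by
  induction n using Nat.strong_induction_on with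
  | _ n ih =>
  intro Y hYn
  rcases Y.eq_empty_or_nonempty with rfl | hY
  · rw [card_labelings_empty]
    obtain rfl : n = 0 := by simpa using hYn.symm
    exact ⟨by decide, fun _ => by decide, fun _ => Or.inl (by simp [IsMatchingOn])⟩
  have hmatch : IsMatchingOn G Y → Even n ∧ labelingBound n ≤ 6 * (labelings G Y).card := by
    intro hM
    obtain ⟨u, hu⟩ := hY
    obtain ⟨v, hv, huv, -⟩ := hM u hu
    obtain ⟨hNu, hNv, hM'⟩ := hM.sdiff hu hv huv
    have hcard := card_sdiff_pair hu hv huv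
    obtain ⟨m, rfl⟩ : ∃ m, n = m + 2 := ⟨(Y \ {v, u}).card, by omega⟩
    obtain ⟨h1, h2⟩ := (ih m (by omega) _ (by omega)).2.1 hM'
    have := six_mul_card_labelings_sdiff_le hu hv huv hNu hNv
    exact ⟨h1.add even_two, by rw [labelingBound]; omega⟩
  suffices h : 6 * (labelings G Y).card ≤ labelingBound n ∧
      (6 * (labelings G Y).card = labelingBound n →
        IsMatchingOn G Y ∨ IsMatchingWithTriangleOn G Y) from
    ⟨h.1, fun hM => ⟨(hmatch hM).1, le_antisymm h.1 (hmatch hM).2⟩, h.2⟩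
  rcases exists_reduction G hY with ⟨v, hv, hN⟩ | ⟨u, hu, v, hv, huv, hNu⟩ |
    ⟨a, ha, b, hb, c, hc, hab, hac, hbc, hNa, hNb⟩ | ⟨x, l, hC⟩
  · have h1 := card_labelings_le_of_isolated hv hN
    have hcard : (Y \ {v}).card + 1 = Y.card :=
      Finset.card_sdiff_add_card_eq_card (by simpa using hv)
    obtain ⟨m, rfl⟩ : ∃ m, n = m + 1 := ⟨(Y \ {v}).card, by omega⟩
    have h2 := (ih m (by omega) (Y \ {v}) (by omega)).1
    have h3 := seven_mul_labelingBound_le m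
    have h4 := labelingBound_pos m
    -- The factor 2 is strictly below 7/3, so equality never occurs with an isolated vertex.
    exact ⟨by omega, fun _ => by omega⟩
  · have h1 := card_labelings_le_of_leaf hu hv huv hNu
    have hcard := card_sdiff_pair hu hv huv
    obtain ⟨m, rfl⟩ : ∃ m, n = m + 2 := ⟨(Y \ {v, u}).card, by omega⟩
    obtain ⟨h2, -, h3⟩ := ih m (by omega) (Y \ {v, u}) (by omega)
    rw [labelingBound]
    refine ⟨by omega, fun heq => ?_⟩
    have hext := h3 (by omega)
    have hNv : ∀ w ∈ Y, G.Adj v w → w = u := by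
      by_contra! hne
      obtain ⟨t, htY, hvt, htu⟩ := hne
      have ht : t ∈ Y \ {v, u} := by simp [htY, htu, hvt.ne']
      obtain ⟨w, hw, htw, hwN⟩ : ∃ w ∈ Y \ {v, u}, G.Adj t w ∧
          ∀ z ∈ Y \ {v, u}, G.Adj w z → z = t ∨ G.Adj t z := by
        rcases hext with h | h
        exacts [h.exists_nbr ht, h.exists_nbr ht]
      have := card_labelings_lt_of_leaf hu hv huv hNu ht hvt hw htw hwN
      omega
    exact hext.imp (IsMatchingOn.of_sdiff hu hv huv hNu hNv)
      (IsMatchingWithTriangleOn.of_sdiff hu hv huv hNu hNv)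
  · have h1 := card_labelings_le_of_triangle ha hb hc hab hac hbc hNa
    have hcard := card_sdiff_triple ha hb hc hab hac hbc
    obtain ⟨m, rfl⟩ : ∃ m, n = m + 3 := ⟨(Y \ {c, a, b}).card, by omega⟩
    obtain ⟨h2, -, h3⟩ := ih m (by omega) (Y \ {c, a, b}) (by omega)
    obtain ⟨h4, h5⟩ := fourteen_mul_labelingBound m
    refine ⟨by omega, fun heq => ?_⟩
    have hev := h5 (by omega)
    -- Equality forces `m` to be even, whereas a matching together with a triangle has an odd number
    -- of vertices. So there is no second triangle.
    have hM : IsMatchingOn G (Y \ {c, a, b}) := by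
      rcases h3 (by omega) with h | ⟨a', b', c', hT, hM⟩
      · exact h
      · have hc' := card_sdiff_triple hT.mem₁ hT.mem₂ hT.mem₃ hT.adj₁₂ hT.adj₁₃ hT.adj₂₃
        have := ((ih _ (by omega) _ rfl).2.1 hM).1
        rw [Nat.even_iff] at this hev
        omega
    refine Or.inr ⟨a, b, c, ⟨ha, hb, hc, hab, hac, hbc, hNa, hNb, ?_⟩, hM⟩
    by_contra! hne
    obtain ⟨t, htY, hct, hta, htb⟩ := hne
    have ht : t ∈ Y \ {c, a, b} := by simp [htY, hta, htb, hct.ne']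
    obtain ⟨w, hw, htw, hwN⟩ := hM.exists_nbr ht
    have := card_labelings_lt_of_triangle ha hb hc hab hac hbc hNa ht hct hw htw hwN
    omega
  · have h1 := card_labelings_le_of_cycle hC.subset hC.isChain hC.closed
    have hcard : (Y \ (x :: l).toFinset).card + (l.length + 1) = Y.card := by
      rw [← List.length_cons (a := x), ← List.toFinset_card_of_nodup hC.nodup]
      exact Finset.card_sdiff_add_card_eq_card
        fun v hv => hC.subset v (List.mem_toFinset.1 hv)
    obtain ⟨k, hk⟩ : ∃ k, l.length = k + 3 := ⟨l.length - 3, by have := hC.three_le; omega⟩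
    have h2 := (ih (Y \ (x :: l).toFinset).card (by omega) _ rfl).1
    have h3 := numClosedSignWalks_mul_labelingBound_lt k (Y \ (x :: l).toFinset).card
    rw [show (Y \ (x :: l).toFinset).card + (k + 4) = n by omega] at h3
    have h4 : 6 * (labelings G Y).card < labelingBound n := by
      rw [hk] at h1
      calc 6 * (labelings G Y).card
          ≤ 6 * (numClosedSignWalks (k + 3) * (labelings G (Y \ (x :: l).toFinset)).card) := by
            omega
        _ = numClosedSignWalks (k + 3) * (6 * (labelings G (Y \ (x :: l).toFinset)).card) := by
            ring
        _ ≤ _ := Nat.mul_le_mul_left _ h2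
        _ < _ := h3
    exact ⟨h4.le, fun h => absurd h h4.ne⟩

theorem six_mul_card_labelings_le (G : SimpleGraph V) (Y : Finset V) :
    6 * (labelings G Y).card ≤ labelingBound Y.card :=
  (six_mul_card_labelings_le_and G _ Y rfl).1

theorem IsMatchingOn.even_card (h : IsMatchingOn G Y) : Even Y.card :=
  ((six_mul_card_labelings_le_and G _ Y rfl).2.1 h).1

theorem IsMatchingWithTriangleOn.odd_card (h : IsMatchingWithTriangleOn G Y) : Odd Y.card := by
  obtain ⟨a, b, c, hT, hM⟩ := h
  have hc := card_sdiff_triple hT.mem₁ hT.mem₂ hT.mem₃ hT.adj₁₂ hT.adj₁₃ hT.adj₂₃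
  have := hM.even_card
  rw [Nat.even_iff] at this
  rw [Nat.odd_iff]
  omega

theorem card_labelings_eq_iff_of_even (hY : Even Y.card) :
    6 * (labelings G Y).card = labelingBound Y.card ↔ IsMatchingOn G Y := by
  obtain ⟨-, h1, h2⟩ := six_mul_card_labelings_le_and G _ Y rfl
  refine ⟨fun h => (h2 h).resolve_right fun hT => ?_, fun h => (h1 h).2⟩
  exact Nat.not_odd_iff_even.2 hY hT.odd_card

theorem card_labelings_eq_iff_of_odd (hY : Odd Y.card) :
    6 * (labelings G Y).card = labelingBound Y.card ↔ IsMatchingWithTriangleOn G Y := by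
  obtain ⟨h0, -, h2⟩ := six_mul_card_labelings_le_and G _ Y rfl
  refine ⟨fun h => (h2 h).resolve_left fun hM => ?_, ?_⟩
  · exact Nat.not_odd_iff_even.2 hM.even_card hY
  · rintro ⟨a, b, c, hT, hM⟩
    have hc := card_sdiff_triple hT.mem₁ hT.mem₂ hT.mem₃ hT.adj₁₂ hT.adj₁₃ hT.adj₂₃
    obtain ⟨hev, h3⟩ := (six_mul_card_labelings_le_and G _ _ rfl).2.1 hM
    have h4 := fourteen_mul_card_labelings_sdiff_le hT
    obtain ⟨k, hk⟩ := hev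
    rw [hk, ← two_mul, labelingBound_even] at h3
    rw [show Y.card = 2 * (k + 1) + 1 by omega, labelingBound_odd] at h0 ⊢
    rw [pow_succ] at h0 h3 ⊢
    omega

end Extremal

/-! ### The lower bound for labelings -/

section LowerBound

variable {V : Type*} {G : SimpleGraph V}

open Classical in
/-- The labeling that is `1` on `A`, `0` on the other neighbours of `A`, and `-1` elsewhere. -/
noncomputable def labelingOfSet (G : SimpleGraph V) (A : Finset V) (v : V) : SignType :=
  if v ∈ A then 1 else if ∃ a ∈ A, G.Adj v a then 0 else -1

theorem labelingOfSet_eq_one {A : Finset V} {v : V} : labelingOfSet G A v = 1 ↔ v ∈ A := by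
  unfold labelingOfSet
  split_ifs with h h' <;> simp [h]

theorem labelingOfSet_injective : Function.Injective (labelingOfSet G) := by
  intro A B h
  ext v
  rw [← labelingOfSet_eq_one (G := G), h, labelingOfSet_eq_one]

variable [Fintype V]

theorem isLabeling_labelingOfSet (A : Finset V) :
    IsLabeling G Finset.univ (labelingOfSet G A) where
  eq_zero v hv := absurd (Finset.mem_univ v) hv
  mul_ne u v huv := by
    unfold labelingOfSet
    by_cases hu : u ∈ A
    · rw [if_pos hu, if_pos (c := ∃ a ∈ A, G.Adj v a) ⟨u, hu, huv.symm⟩]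
      split_ifs <;> decide
    by_cases hv : v ∈ A
    · rw [if_pos hv, if_pos (c := ∃ a ∈ A, G.Adj u a) ⟨v, hv, huv⟩, if_neg hu]
      decide
    rw [if_neg hu, if_neg hv]
    split_ifs <;> decide
  dominated v _ h := by
    unfold labelingOfSet at h
    split_ifs at h with h1 h2
    · obtain ⟨a, ha, hva⟩ := h2
      exact ⟨a, hva, by rw [labelingOfSet_eq_one.2 ha]; decide⟩

theorem two_pow_le_card_labelings (G : SimpleGraph V) :
    2 ^ Fintype.card V ≤ (labelings G Finset.univ).card := by
  classical
  rw [← Fintype.card_finset, ← Finset.card_univ]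
  exact Finset.card_le_card_of_injOn (labelingOfSet G)
    (fun A _ => by simpa [mem_labelings] using isLabeling_labelingOfSet A)
    labelingOfSet_injective.injOn

theorem card_labelings_eq_two_pow_iff :
    (labelings G Finset.univ).card = 2 ^ Fintype.card V ↔ G = ⊥ := by
  classical
  constructor
  · intro h
    by_contra hne
    obtain ⟨u, v, huv⟩ := SimpleGraph.ne_bot_iff_exists_adj.1 hne
    -- This labeling never takes the value 1, so it could only come from the empty set, which gives
    -- -1 everywhere, including at `u`.
    set g : V → SignType := fun x => if x = u then 0 else -1 with hg
    have hgL : IsLabeling G Finset.univ g := by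
      refine ⟨fun x hx => absurd (Finset.mem_univ x) hx, fun x y _ => ?_, fun x _ hx => ?_⟩
      · simp only [hg]
        split_ifs <;> decide
      · have hxu : x = u := by
          by_contra hxu
          simp [hg, hxu] at hx
        exact ⟨v, hxu ▸ huv, by simp [hg, huv.ne']⟩
    have himg : Finset.univ.image (labelingOfSet G) = labelings G Finset.univ := by
      refine Finset.eq_of_subset_of_card_le (fun f hf => ?_) ?_
      · obtain ⟨A, -, rfl⟩ := Finset.mem_image.1 hf
        exact mem_labelings.2 (isLabeling_labelingOfSet A)
      · rw [Finset.card_image_of_injective _ labelingOfSet_injective, h, Finset.card_univ,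
          Fintype.card_finset]
    obtain ⟨A, -, hA⟩ := Finset.mem_image.1 (himg ▸ mem_labelings.2 hgL)
    have hA0 : ∀ x, x ∉ A := fun x hx => by
      rw [← labelingOfSet_eq_one (G := G), hA] at hx
      simp only [hg] at hx
      split_ifs at hx
    have hu := congrFun hA u
    simp [labelingOfSet, hA0, hg] at hu
  · rintro rfl
    refine le_antisymm ?_ (two_pow_le_card_labelings _)
    have h : ∀ f ∈ labelings (⊥ : SimpleGraph V) Finset.univ,
        f ∈ Fintype.piFinset fun _ : V => ({1, -1} : Finset SignType) := by
      intro f hf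
      rw [Fintype.mem_piFinset]
      intro v
      rcases SignType.trichotomy (f v) with h | h | h
      · simp [h]
      · obtain ⟨w, hw, -⟩ := (mem_labelings.1 hf).dominated v (Finset.mem_univ v) h
        exact absurd hw (by simp)
      · simp [h]
    refine (Finset.card_le_card h).trans ?_
    rw [Fintype.card_piFinset]
    simp

end LowerBound

/-! ### Faces of convex hulls and their dimensions -/

section Exposed

variable {E : Type*} [AddCommGroup E] [Module ℝ E]

/-- A point of a convex hull where a linear functional attains its maximum lies in the span of the
generators where it does. -/
theorem mem_span_of_mem_convexHull {S : Set E} (l : E →ₗ[ℝ] ℝ) {M : ℝ} (hS : ∀ s ∈ S, l s ≤ M)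
    {x : E} (hx : x ∈ convexHull ℝ S) :
    l x ≤ M ∧ (l x = M → x ∈ Submodule.span ℝ {s ∈ S | l s = M}) := by
  have hconv : Convex ℝ {x : E | l x ≤ M ∧ (l x = M → x ∈ Submodule.span ℝ {s ∈ S | l s = M})} := by
    rw [convex_iff_forall_pos]
    rintro x ⟨hx, hx'⟩ y ⟨hy, hy'⟩ a b ha hb hab
    have h1 : a * l x ≤ a * M := mul_le_mul_of_nonneg_left hx ha.le
    have h2 : b * l y ≤ b * M := mul_le_mul_of_nonneg_left hy hb.le
    have h3 : a * M + b * M = M := by rw [← add_mul, hab, one_mul]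
    simp only [Set.mem_ofPred_eq, map_add, map_smul, smul_eq_mul]
    refine ⟨by linarith, fun h => Submodule.add_mem _ (Submodule.smul_mem _ _ (hx' ?_))
      (Submodule.smul_mem _ _ (hy' ?_))⟩
    · exact mul_left_cancel₀ ha.ne' (by linarith)
    · exact mul_left_cancel₀ hb.ne' (by linarith)
  have hsub : S ⊆ {x : E | l x ≤ M ∧ (l x = M → x ∈ Submodule.span ℝ {s ∈ S | l s = M})} :=
    fun s hs => ⟨hS s hs, fun h => Submodule.subset_span ⟨hs, h⟩⟩
  exact convexHull_min hsub hconv hx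

/-- `F` lies in an affine hyperplane off the origin, so its linear span is its direction space plus
the independent line through any of its points. -/
theorem finrank_span_eq_finrank_vectorSpan_add_one [FiniteDimensional ℝ E] {F : Set E}
    (l : E →ₗ[ℝ] ℝ) {M : ℝ} (hM : M ≠ 0) (hF : ∀ x ∈ F, l x = M) (hne : F.Nonempty) :
    Module.finrank ℝ (Submodule.span ℝ F) = Module.finrank ℝ (vectorSpan ℝ F) + 1 := by
  obtain ⟨p, hp⟩ := hne
  have hker : vectorSpan ℝ F ≤ LinearMap.ker l := by
    rw [vectorSpan_def, Submodule.span_le]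
    rintro _ ⟨x, hx, y, hy, rfl⟩
    simp [hF x hx, hF y hy]
  have hpW : p ∉ vectorSpan ℝ F := fun h => hM (by rw [← hF p hp]; exact hker h)
  have hp0 : p ≠ 0 := by
    rintro rfl
    exact hpW (Submodule.zero_mem _)
  have hsup : Submodule.span ℝ F = vectorSpan ℝ F ⊔ Submodule.span ℝ {p} := by
    apply le_antisymm
    · rw [Submodule.span_le]
      intro x hx
      rw [← sub_add_cancel x p]
      exact Submodule.add_mem_sup (vsub_mem_vectorSpan ℝ hx hp) (Submodule.mem_span_singleton_self p)
    · refine sup_le ?_ (Submodule.span_mono (by simpa using hp))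
      rw [vectorSpan_def, Submodule.span_le]
      rintro _ ⟨x, hx, y, hy, rfl⟩
      exact Submodule.sub_mem _ (Submodule.subset_span hx) (Submodule.subset_span hy)
  have hinf : vectorSpan ℝ F ⊓ Submodule.span ℝ {p} = ⊥ :=
    (Submodule.disjoint_span_singleton_of_notMem hpW).eq_bot
  have := Submodule.finrank_sup_add_finrank_inf_eq (vectorSpan ℝ F) (Submodule.span ℝ {p})
  rw [hinf, finrank_bot, finrank_span_singleton hp0, ← hsup] at this
  omega

end Exposed

/-! ### Facets of symmetric edge polytopes -/

section SymmetricEdgePolytope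

variable {W : Type*} [DecidableEq W]

/-- The vectors `e_i - e_j` with `{i, j}` an edge of `H`. -/
def edgeVectors (H : SimpleGraph W) : Set (W → ℝ) :=
  {x | ∃ i j : W, H.Adj i j ∧ x = Pi.single i (1 : ℝ) - Pi.single j (1 : ℝ)}

theorem neg_mem_edgeVectors {H : SimpleGraph W} {x : W → ℝ} (hx : x ∈ edgeVectors H) :
    -x ∈ edgeVectors H := by
  obtain ⟨i, j, hij, rfl⟩ := hx
  exact ⟨j, i, hij.symm, by abel⟩

theorem symmetricEdgePolytope_eq (H : SimpleGraph W) :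
    symmetricEdgePolytope H = convexHull ℝ (edgeVectors H) := rfl

theorem edgeVectors_subset (H : SimpleGraph W) : edgeVectors H ⊆ symmetricEdgePolytope H :=
  subset_convexHull ℝ _

theorem span_symmetricEdgePolytope (H : SimpleGraph W) :
    Submodule.span ℝ (symmetricEdgePolytope H) = Submodule.span ℝ (edgeVectors H) :=
  le_antisymm (Submodule.span_le.2 (convexHull_min Submodule.subset_span (Submodule.convex _)))
    (Submodule.span_mono (edgeVectors_subset H))

theorem vectorSpan_symmetricEdgePolytope (H : SimpleGraph W) (hH : (edgeVectors H).Nonempty) :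
    vectorSpan ℝ (symmetricEdgePolytope H) = Submodule.span ℝ (edgeVectors H) := by
  obtain ⟨x, hx⟩ := hH
  have h0 : (0 : W → ℝ) ∈ symmetricEdgePolytope H := by
    have := (convex_convexHull ℝ (edgeVectors H)) (subset_convexHull ℝ _ hx)
      (subset_convexHull ℝ _ (neg_mem_edgeVectors hx)) (a := 1 / 2) (b := 1 / 2) (by norm_num)
      (by norm_num) (by norm_num)
    simpa [symmetricEdgePolytope_eq] using this
  rw [vectorSpan_eq_span_vsub_set_right ℝ h0, ← span_symmetricEdgePolytope]
  simp

/-- Every facet of the symmetric edge polytope is cut out by a positive maximum. -/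
theorem IsFacet.exists_pos {H : SimpleGraph W} {F : Set (W → ℝ)}
    (hF : IsFacet (symmetricEdgePolytope H) F) : ∃ l : (W → ℝ) →L[ℝ] ℝ, ∃ M : ℝ, 0 < M ∧
      (∀ x ∈ edgeVectors H, l x ≤ M) ∧ F = {x ∈ symmetricEdgePolytope H | l x = M} := by
  obtain ⟨hexp, hne, hdim⟩ := hF
  obtain ⟨l, hl⟩ := hexp hne
  obtain ⟨p, hp⟩ := hne
  have hp' := hp
  rw [hl] at hp'
  have hle : ∀ x ∈ edgeVectors H, l x ≤ l p := fun x hx => hp'.2 x (edgeVectors_subset H hx)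
  have heq : F = {x ∈ symmetricEdgePolytope H | l x = l p} := by
    rw [hl]
    ext x
    refine ⟨fun hx => ⟨hx.1, le_antisymm (hp'.2 x hx.1) (hx.2 p hp'.1)⟩, fun hx => ⟨hx.1, ?_⟩⟩
    intro y hy
    rw [hx.2]
    exact hp'.2 y hy
  refine ⟨l, l p, ?_, hle, heq⟩
  by_contra hneg
  -- If the maximum were not positive, central symmetry would make `l` vanish on all edge vectors.
  -- The face would then be the whole polytope, against the dimension count.
  have hz : ∀ x ∈ edgeVectors H, l x = l p := by
    have hx0 : ∀ x ∈ edgeVectors H, l x ≤ 0 := fun x hx => (hle x hx).trans (not_lt.1 hneg)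
    have hx1 : ∀ x ∈ edgeVectors H, l x = 0 := fun x hx => by
      have := hx0 _ (neg_mem_edgeVectors hx)
      rw [map_neg] at this
      exact le_antisymm (hx0 x hx) (by linarith)
    intro x hx
    refine le_antisymm (hle x hx) ?_
    rw [hx1 x hx]
    exact not_lt.1 hneg
  have hFP : F = symmetricEdgePolytope H := by
    rw [heq]
    refine Set.Subset.antisymm (fun x hx => hx.1) ?_
    refine convexHull_min (fun x hx => ⟨edgeVectors_subset H hx, hz x hx⟩) ?_
    rw [← Set.inter_ofPred_eq_sep]
    exact (convex_convexHull ℝ _).inter (convex_hyperplane l.isLinear _)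
  rw [hFP] at hdim
  omega

variable [Finite W]

/-- Facets of the symmetric edge polytope, in terms of the span of their vertices. -/
theorem isFacet_iff_of_pos {H : SimpleGraph W} (hH : (edgeVectors H).Nonempty)
    (l : (W → ℝ) →L[ℝ] ℝ) {M : ℝ} (hM : 0 < M) (hl : ∀ x ∈ edgeVectors H, l x ≤ M) :
    IsFacet (symmetricEdgePolytope H) {x ∈ symmetricEdgePolytope H | l x = M} ↔
      Submodule.span ℝ {x ∈ edgeVectors H | l x = M} = Submodule.span ℝ (edgeVectors H) := by
  have := Fintype.ofFinite W
  set F := {x ∈ symmetricEdgePolytope H | l x = M} with hF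
  have hle : ∀ x ∈ symmetricEdgePolytope H, l x ≤ M := fun x hx =>
    (mem_span_of_mem_convexHull l.toLinearMap hl hx).1
  have hspan : Submodule.span ℝ F = Submodule.span ℝ {x ∈ edgeVectors H | l x = M} := by
    apply le_antisymm
    · exact Submodule.span_le.2 fun x hx =>
        (mem_span_of_mem_convexHull l.toLinearMap hl hx.1).2 hx.2
    · exact Submodule.span_mono fun x hx => ⟨edgeVectors_subset H hx.1, hx.2⟩
  have hsub : Submodule.span ℝ {x ∈ edgeVectors H | l x = M} ≤ Submodule.span ℝ (edgeVectors H) :=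
    Submodule.span_mono fun x hx => hx.1
  have hexp : IsExposed ℝ (symmetricEdgePolytope H) F := by
    rintro ⟨p, hp⟩
    refine ⟨l, Set.ext fun x => ⟨fun hx => ⟨hx.1, fun y hy => by rw [hx.2]; exact hle y hy⟩,
      fun hx => ⟨hx.1, le_antisymm (hle x hx.1) ?_⟩⟩⟩
    have := hx.2 p hp.1
    rwa [hp.2] at this
  rw [IsFacet, vectorSpan_symmetricEdgePolytope H hH, ← hspan]
  rw [← hspan] at hsub
  constructor
  · rintro ⟨-, hne, hdim⟩
    rw [← finrank_span_eq_finrank_vectorSpan_add_one l.toLinearMap hM.ne' (fun x hx => hx.2) hne]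
      at hdim
    exact Submodule.eq_of_le_of_finrank_eq hsub hdim
  · intro h
    have hne : F.Nonempty := by
      rw [Set.nonempty_iff_ne_empty]
      intro hemp
      rw [hemp, Submodule.span_empty] at h
      obtain ⟨x, hx⟩ := hH
      have hx0 : x = 0 := by
        have := Submodule.subset_span (R := ℝ) hx
        rw [← h] at this
        simpa using this
      obtain ⟨i, j, hij, rfl⟩ := hx
      have := congrFun hx0 i
      simp [hij.ne] at this
    refine ⟨hexp, hne, ?_⟩
    rw [← finrank_span_eq_finrank_vectorSpan_add_one l.toLinearMap hM.ne' (fun x hx => hx.2) hne, h]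

end SymmetricEdgePolytope

/-! ### Facets of the suspension correspond to labelings -/

section Suspension

variable {V : Type*} {G : SimpleGraph V}

/-- The potential on the suspension that is zero at the apex and `c` elsewhere. -/
def extendZero (c : V → ℝ) (o : Option V) : ℝ := o.elim 0 c

theorem edgeVectors_suspension_nonempty [DecidableEq V] [Nonempty V] :
    (edgeVectors (suspension G)).Nonempty :=
  let ⟨v⟩ := ‹Nonempty V›
  ⟨_, some v, none, trivial, rfl⟩

variable [Fintype V]

/-- The linear functional on `ℝ^(Option V)` with coefficients `c`, and zero at the apex. -/
noncomputable def potentialForm (c : V → ℝ) : (Option V → ℝ) →L[ℝ] ℝ :=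
  ∑ v, c v • ContinuousLinearMap.proj (some v)

theorem potentialForm_apply (c : V → ℝ) (x : Option V → ℝ) :
    potentialForm c x = ∑ v, c v * x (some v) := by
  simp [potentialForm]

variable [DecidableEq V]

theorem potentialForm_single (c : V → ℝ) (o : Option V) :
    potentialForm c (Pi.single o 1) = extendZero c o := by
  rw [potentialForm_apply]
  cases o with
  | none => simp [extendZero]
  | some w => simp [extendZero, Pi.single_apply]

theorem potentialForm_edge (c : V → ℝ) (i j : Option V) :
    potentialForm c (Pi.single i 1 - Pi.single j 1) = extendZero c i - extendZero c j := by
  rw [map_sub, potentialForm_single, potentialForm_single]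

/-- The face of the symmetric edge polytope of the suspension given by the potential `c`. -/
def potentialFace (G : SimpleGraph V) (c : V → ℝ) : Set (Option V → ℝ) :=
  {x ∈ symmetricEdgePolytope (suspension G) | potentialForm c x = 1}

theorem isFacet_potentialFace_iff [Nonempty V] {c : V → ℝ}
    (hc : ∀ x ∈ edgeVectors (suspension G), potentialForm c x ≤ 1) :
    IsFacet (symmetricEdgePolytope (suspension G)) (potentialFace G c) ↔
      Submodule.span ℝ {x ∈ edgeVectors (suspension G) | potentialForm c x = 1} =
        Submodule.span ℝ (edgeVectors (suspension G)) :=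
  isFacet_iff_of_pos edgeVectors_suspension_nonempty _ one_pos hc

/-- Subtracting the apex value and dividing by the maximum normalises the functional. The
subtraction does not change differences, hence does not matter on the span of the edge vectors. -/
theorem exists_potentialFace_eq {F : Set (Option V → ℝ)}
    (hF : IsFacet (symmetricEdgePolytope (suspension G)) F) :
    ∃ c : V → ℝ, (∀ x ∈ edgeVectors (suspension G), potentialForm c x ≤ 1) ∧
      F = potentialFace G c := by
  obtain ⟨l, M, hM, hle, rfl⟩ := hF.exists_pos
  set c : V → ℝ := fun v => (l (Pi.single (some v) 1) - l (Pi.single none 1)) / M with hc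
  have hext : ∀ o, M * extendZero c o = l (Pi.single o 1) - l (Pi.single none 1) := by
    rintro (_ | v)
    · simp [extendZero]
    · simp only [extendZero, Option.elim, hc]
      field_simp
  have hspan : ∀ x ∈ Submodule.span ℝ (edgeVectors (suspension G)),
      l x = M * potentialForm c x := by
    intro x hx
    induction hx using Submodule.span_induction with
    | mem x hx =>
      obtain ⟨i, j, -, rfl⟩ := hx
      rw [potentialForm_edge, mul_sub, hext, hext, map_sub]
      ring
    | zero => simp
    | add x y _ _ hx hy => rw [map_add, map_add, hx, hy]; ring
    | smul a x _ hx => rw [map_smul, map_smul, hx, smul_eq_mul, smul_eq_mul]; ring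
  refine ⟨c, fun x hx => ?_, ?_⟩
  · have := hle x hx
    rw [hspan x (Submodule.subset_span hx)] at this
    exact le_of_mul_le_mul_left (by linarith) hM
  · ext x
    simp only [potentialFace, Set.mem_ofPred_eq]
    refine and_congr_right fun hx => ?_
    rw [hspan x (by rw [← span_symmetricEdgePolytope]; exact Submodule.subset_span hx)]
    constructor
    · intro h
      exact mul_left_cancel₀ hM.ne' (by linarith)
    · intro h
      rw [h, mul_one]

/-- If the edges with potential difference one span, then a potential whose differences vanish on
these edges is zero. -/
theorem eq_zero_of_span_eq {c d : V → ℝ}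
    (hspan : Submodule.span ℝ {x ∈ edgeVectors (suspension G) | potentialForm c x = 1} =
      Submodule.span ℝ (edgeVectors (suspension G)))
    (hd : ∀ i j, (suspension G).Adj i j → extendZero c i - extendZero c j = 1 →
      extendZero d i = extendZero d j) (v : V) : d v = 0 := by
  have hker : Submodule.span ℝ (edgeVectors (suspension G)) ≤
      LinearMap.ker (potentialForm d).toLinearMap := by
    rw [← hspan, Submodule.span_le]
    rintro _ ⟨⟨i, j, hij, rfl⟩, h⟩
    rw [potentialForm_edge] at h
    have := hd i j hij h
    simp only [SetLike.mem_coe, LinearMap.mem_ker, ContinuousLinearMap.coe_coe]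
    rw [potentialForm_edge, this, sub_self]
  have hmem : (Pi.single (some v) 1 - Pi.single none 1 : Option V → ℝ) ∈
      edgeVectors (suspension G) := ⟨some v, none, trivial, rfl⟩
  have := hker (Submodule.subset_span hmem)
  simp only [LinearMap.mem_ker, ContinuousLinearMap.coe_coe] at this
  rw [potentialForm_edge] at this
  simpa [extendZero] using this

theorem exists_isLabeling_of_span_eq {c : V → ℝ}
    (hc : ∀ x ∈ edgeVectors (suspension G), potentialForm c x ≤ 1)
    (hspan : Submodule.span ℝ {x ∈ edgeVectors (suspension G) | potentialForm c x = 1} =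
      Submodule.span ℝ (edgeVectors (suspension G))) :
    ∃ f : V → SignType, IsLabeling G Finset.univ f ∧ c = fun v => (f v : ℝ) := by
  classical
  have hdiff : ∀ i j, (suspension G).Adj i j → extendZero c i - extendZero c j ≤ 1 := by
    intro i j hij
    rw [← potentialForm_edge]
    exact hc _ ⟨i, j, hij, rfl⟩
  have hle : ∀ v, c v ≤ 1 := fun v => by
    simpa [extendZero] using hdiff (some v) none trivial
  have hge : ∀ v, -1 ≤ c v := fun v => by
    have : -c v ≤ 1 := by simpa [extendZero] using hdiff none (some v) trivial
    linarith
  -- The indicator of the vertices with other values is constant along tight edges, because tight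
  -- edges change the potential by 1 and all values lie in [-1, 1]. It is 0 at the apex, so it
  -- vanishes by spanning.
  have hint : ∀ v, c v = -1 ∨ c v = 0 ∨ c v = 1 := by
    intro v
    by_contra hv
    have h := eq_zero_of_span_eq (d := fun v => if c v = -1 ∨ c v = 0 ∨ c v = 1 then 0 else 1)
      hspan ?_ v
    · simp [hv] at h
    · rintro (_ | i) (_ | j) - hij
      · rfl
      · have : c j = -1 := by simp [extendZero] at hij; linarith
        simp [extendZero, this]
      · have : c i = 1 := by simpa [extendZero] using hij
        simp [extendZero, this]
      · simp only [extendZero, Option.elim] at hij ⊢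
        have h1 := hle i
        have h2 := hge j
        have hi : (c i = -1 ∨ c i = 0 ∨ c i = 1) ↔ (c j = -1 ∨ c j = 0 ∨ c j = 1) := by
          constructor
          · rintro (h | h | h)
            · linarith
            · exact Or.inl (by linarith)
            · exact Or.inr (Or.inl (by linarith))
          · rintro (h | h | h)
            · exact Or.inr (Or.inl (by linarith))
            · exact Or.inr (Or.inr (by linarith))
            · linarith
        simp only [hi]
  have hsign : ∀ v, ((SignType.sign (c v) : SignType) : ℝ) = c v := by
    intro v
    rcases hint v with h | h | h <;> rw [h] <;> simp
  have hz : ∀ v, SignType.sign (c v) = 0 ↔ c v = 0 := fun v => sign_eq_zero_iff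
  refine ⟨fun v => SignType.sign (c v), ⟨fun v hv => absurd (Finset.mem_univ v) hv, ?_, ?_⟩,
    funext fun v => (hsign v).symm⟩
  · intro u v huv h
    have h1 := hdiff (some u) (some v) huv
    have h2 := hdiff (some v) (some u) huv.symm
    simp only [extendZero, Option.elim] at h1 h2
    rcases hint u with hu | hu | hu <;> rcases hint v with hv | hv | hv <;>
      first
      | linarith
      | (norm_num [hu, hv] at h; done)
      | (norm_num [hu, hv] at h; exact absurd h (by decide))
  · intro v _ hv
    rw [hz] at hv
    by_contra! hne
    -- A vertex of value 0 with no nonzero neighbour meets no tight edge, so its own indicator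
    -- contradicts spanning.
    have h := eq_zero_of_span_eq (d := fun w => if w = v then 1 else 0) hspan ?_ v
    · simp at h
    · rintro (_ | i) (_ | j) hadj hij
      · rfl
      · have : j ≠ v := by rintro rfl; simp [extendZero, hv] at hij
        simp [extendZero, this]
      · have : i ≠ v := by rintro rfl; simp [extendZero, hv] at hij
        simp [extendZero, this]
      · simp only [extendZero, Option.elim] at hij ⊢
        have hi : i ≠ v := by
          rintro rfl
          have := (hz j).1 (hne j hadj)
          rw [hv, this] at hij
          norm_num at hij
        have hj : j ≠ v := by
          rintro rfl
          have := (hz i).1 (hne i (SimpleGraph.adj_symm _ hadj))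
          rw [hv, this] at hij
          norm_num at hij
        simp [hi, hj]

/-- Tight edges connect everything to the apex: a nonzero vertex directly, a zero vertex through a
nonzero neighbour. -/
theorem span_eq_of_isLabeling {f : V → SignType} (hf : IsLabeling G Finset.univ f) :
    (∀ x ∈ edgeVectors (suspension G), potentialForm (fun v => (f v : ℝ)) x ≤ 1) ∧
    Submodule.span ℝ {x ∈ edgeVectors (suspension G) | potentialForm (fun v => (f v : ℝ)) x = 1} =
      Submodule.span ℝ (edgeVectors (suspension G)) := by
  set c : V → ℝ := fun v => (f v : ℝ) with hc
  set A := {x ∈ edgeVectors (suspension G) | potentialForm c x = 1} with hA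
  have hval : ∀ v, c v = -1 ∨ c v = 0 ∨ c v = 1 := fun v => by
    rcases SignType.trichotomy (f v) with h | h | h <;> simp [hc, h]
  have hbd : ∀ s t : SignType, s * t ≠ -1 → (s : ℝ) - t ≤ 1 := by
    intro s t
    rcases SignType.trichotomy s with rfl | rfl | rfl <;>
      rcases SignType.trichotomy t with rfl | rfl | rfl <;> norm_num
  refine ⟨?_, le_antisymm (Submodule.span_mono fun x hx => hx.1) ?_⟩
  · rintro _ ⟨i, j, hij, rfl⟩
    rw [potentialForm_edge]
    rcases i with _ | i <;> rcases j with _ | j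
    · simp [extendZero]
    · rcases hval j with h | h | h <;> simp [extendZero, h]
    · rcases hval i with h | h | h <;> simp [extendZero, h]
    · exact hbd _ _ (hf.mul_ne i j hij)
  · have hstep : ∀ i j, (suspension G).Adj i j →
        (extendZero c i - extendZero c j = 1 ∨ extendZero c i - extendZero c j = -1) →
        (Pi.single i 1 - Pi.single j 1 : Option V → ℝ) ∈ Submodule.span ℝ A := by
      rintro i j hij (h | h)
      · exact Submodule.subset_span ⟨⟨i, j, hij, rfl⟩, by rw [potentialForm_edge, h]⟩
      · rw [← neg_sub]
        refine Submodule.neg_mem _ (Submodule.subset_span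
          ⟨⟨j, i, SimpleGraph.adj_symm _ hij, rfl⟩, ?_⟩)
        rw [potentialForm_edge]
        linarith
    have hne : ∀ v, c v ≠ 0 →
        (Pi.single (some v) 1 - Pi.single none 1 : Option V → ℝ) ∈ Submodule.span ℝ A := by
      intro v hv
      refine hstep (some v) none trivial ?_
      rcases hval v with h | h | h
      · right; simp [extendZero, h]
      · exact absurd h hv
      · left; simp [extendZero, h]
    have hall : ∀ o, (Pi.single o 1 - Pi.single none 1 : Option V → ℝ) ∈ Submodule.span ℝ A := by
      rintro (_ | v)
      · simp
      · by_cases hv : c v = 0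
        · have hfv : f v = 0 := by
            rcases SignType.trichotomy (f v) with h | h | h <;> simp_all
          obtain ⟨w, hvw, hw⟩ := hf.dominated v (Finset.mem_univ v) hfv
          have hcw : c w ≠ 0 := by
            rcases SignType.trichotomy (f w) with h | h | h <;> simp_all
          rw [← sub_add_sub_cancel _ (Pi.single (some w) 1 : Option V → ℝ)]
          refine Submodule.add_mem _ (hstep _ _ hvw ?_) (hne w hcw)
          rcases hval w with h | h | h
          · left; simp [extendZero, h, hv]
          · exact absurd h hcw
          · right; simp [extendZero, h, hv]
        · exact hne v hv
    rw [Submodule.span_le]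
    rintro _ ⟨i, j, -, rfl⟩
    rw [← sub_sub_sub_cancel_right _ _ (Pi.single none 1 : Option V → ℝ)]
    exact Submodule.sub_mem _ (hall i) (hall j)

/-- The face determines `f`, since the two edge vectors between `v` and the apex detect the values 1
and -1. -/
theorem potentialFace_injective :
    Function.Injective fun f : V → SignType => potentialFace G fun v => (f v : ℝ) := by
  have key : ∀ (f : V → SignType) (v : V),
      ((Pi.single (some v) 1 - Pi.single none 1 : Option V → ℝ) ∈
        potentialFace G (fun v => (f v : ℝ)) ↔ f v = 1) ∧
      ((Pi.single none 1 - Pi.single (some v) 1 : Option V → ℝ) ∈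
        potentialFace G (fun v => (f v : ℝ)) ↔ f v = -1) := by
    intro f v
    have h1 : (Pi.single (some v) 1 - Pi.single none 1 : Option V → ℝ) ∈
        symmetricEdgePolytope (suspension G) := edgeVectors_subset _ ⟨some v, none, trivial, rfl⟩
    have h2 : (Pi.single none 1 - Pi.single (some v) 1 : Option V → ℝ) ∈
        symmetricEdgePolytope (suspension G) := edgeVectors_subset _ ⟨none, some v, trivial, rfl⟩
    simp only [potentialFace, Set.mem_ofPred_eq, h1, h2, true_and, potentialForm_edge, extendZero,
      Option.elim]
    rcases SignType.trichotomy (f v) with h | h | h <;> rw [h] <;> norm_num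
    decide
  intro f g h
  ext1 v
  have h' : potentialFace G (fun v => (f v : ℝ)) = potentialFace G (fun v => (g v : ℝ)) := h
  have h1 := (key f v).1.symm.trans (h' ▸ (key g v).1)
  have h2 := (key f v).2.symm.trans (h' ▸ (key g v).2)
  rcases SignType.trichotomy (f v) with hf | hf | hf
  · rw [hf, h2.1 hf]
  · rcases SignType.trichotomy (g v) with hg | hg | hg
    · rw [hg, h2.2 hg]
    · rw [hf, hg]
    · rw [hg, h1.2 hg]
  · rw [hf, h1.1 hf]

/-- The facets of the symmetric edge polytope of the suspension of `G` correspond to the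
labelings of `G`. -/
theorem numFacets_suspension [Nonempty V] (G : SimpleGraph V) :
    numFacets (suspension G) = (labelings G Finset.univ).card := by
  rw [numFacets, ← Set.ncard_coe_finset,
    ← Set.ncard_image_of_injective _ (potentialFace_injective (G := G))]
  congr 1
  ext F
  simp only [Set.mem_ofPred_eq, Set.mem_image, Finset.mem_coe, mem_labelings]
  constructor
  · intro hF
    obtain ⟨c, hc, rfl⟩ := exists_potentialFace_eq hF
    obtain ⟨f, hf, rfl⟩ := exists_isLabeling_of_span_eq hc ((isFacet_potentialFace_iff hc).1 hF)
    exact ⟨f, hf, rfl⟩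
  · rintro ⟨f, hf, rfl⟩
    obtain ⟨h1, h2⟩ := span_eq_of_isLabeling hf
    exact (isFacet_potentialFace_iff h1).2 h2

end Suspension

/-! ### Extremal graphs up to isomorphism -/

section Isomorphisms

theorem ne_add_one_of_fin_two : ∀ b : Fin 2, b ≠ b + 1 := by decide

theorem eq_add_one_of_ne_of_fin_two : ∀ b b' : Fin 2, b ≠ b' → b' = b + 1 := by decide

variable {V : Type*} {G : SimpleGraph V}

theorem nonempty_iso_top [Fintype V] {m : ℕ} (hcard : Fintype.card V = m)
    (h : ∀ u v, u ≠ v → G.Adj u v) : Nonempty (G ≃g (⊤ : SimpleGraph (Fin m))) :=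
  ⟨⟨Fintype.equivFinOfCardEq hcard, fun {u v} => by
    simpa using ⟨fun huv => h u v huv, fun huv => huv.ne⟩⟩⟩

theorem nonempty_iso_disjointEdges [Fintype V] {k : ℕ} (hcard : Fintype.card V = 2 * k)
    (h : ∀ v, ∃ w, G.Adj v w ∧ ∀ z, G.Adj v z → z = w) : Nonempty (G ≃g disjointEdges k) := by
  classical
  choose m hm hm' using h
  have hinv : ∀ v, m (m v) = v := fun v => (hm' (m v) v (hm v).symm).symm
  -- The neighbour map is a fixed-point-free involution; its orbits are the edges.
  let r : Setoid V :=
    { r := fun u v => u = v ∨ v = m u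
      iseqv :=
        { refl := fun _ => Or.inl rfl
          symm := by
            rintro u v (rfl | rfl)
            exacts [Or.inl rfl, Or.inr (hinv u).symm]
          trans := by
            rintro u v w (rfl | rfl) (rfl | rfl)
            exacts [Or.inl rfl, Or.inr rfl, Or.inr rfl, Or.inl (hinv u).symm] } }
  have hmk : ∀ u v, Quotient.mk r u = Quotient.mk r v ↔ u = v ∨ v = m u := fun u v =>
    Quotient.eq
  have hfib : ∀ q, Fintype.card {v // Quotient.mk r v = q} = 2 := by
    intro q
    obtain ⟨u, rfl⟩ := Quotient.exists_rep q
    rw [Fintype.card_subtype, ← Finset.card_pair (hm u).ne]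
    congr 1
    ext v
    simp only [Finset.mem_filter, Finset.mem_univ, true_and, Finset.mem_insert,
      Finset.mem_singleton]
    rw [eq_comm, hmk, eq_comm]
  have hQ : Fintype.card (Quotient r) = k := by
    have h1 := Fintype.card_congr (Equiv.sigmaFiberEquiv (Quotient.mk r))
    rw [Fintype.card_sigma] at h1
    simp only [hfib, Finset.sum_const, Finset.card_univ, smul_eq_mul] at h1
    omega
  let φ := Fintype.equivFinOfCardEq hQ
  let e : V ≃ Fin k × Fin 2 :=
    (Equiv.sigmaFiberEquiv (Quotient.mk r)).symm.trans
      ((Equiv.sigmaCongrRight fun q => Fintype.equivFinOfCardEq (hfib q)).trans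
        ((Equiv.sigmaEquivProd _ _).trans (φ.prodCongr (Equiv.refl _))))
  have he : ∀ v, (e v).1 = φ (Quotient.mk r v) := fun v => rfl
  refine ⟨⟨e, fun {u v} => ?_⟩⟩
  have h1 : (disjointEdges k).Adj (e u) (e v) ↔ (e u).1 = (e v).1 ∧ (e u).2 ≠ (e v).2 := Iff.rfl
  rw [h1]
  constructor
  · rintro ⟨h2, h3⟩
    rw [he, he, φ.injective.eq_iff, hmk] at h2
    rcases h2 with rfl | rfl
    exacts [absurd rfl h3, hm u]
  · intro huv
    have h2 : (e u).1 = (e v).1 := by rw [he, he, (hmk u v).2 (Or.inr (hm' u v huv))]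
    exact ⟨h2, fun h3 => huv.ne (e.injective (Prod.ext h2 h3))⟩

theorem isMatchingOn_univ_iff [Fintype V] {k : ℕ} (hcard : Fintype.card V = 2 * k) :
    IsMatchingOn G Finset.univ ↔ Nonempty (G ≃g disjointEdges k) := by
  constructor
  · intro h
    refine nonempty_iso_disjointEdges hcard fun v => ?_
    simpa using h v (Finset.mem_univ v)
  · rintro ⟨e⟩ v -
    refine ⟨e.symm ((e v).1, (e v).2 + 1), Finset.mem_univ _, ?_, fun z _ hz => ?_⟩
    · rw [← e.map_adj_iff, e.apply_symm_apply]
      exact ⟨rfl, ne_add_one_of_fin_two _⟩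
    · rw [← e.map_adj_iff] at hz
      rw [e.eq_symm_apply]
      exact Prod.ext hz.1.symm (eq_add_one_of_ne_of_fin_two _ _ hz.2)

/-- A graph without edges between `s` and its complement is a disjoint sum. -/
theorem nonempty_iso_sum_induce (s : Set V) (h : ∀ u ∈ s, ∀ v, G.Adj u v → v ∈ s) :
    Nonempty (G ≃g (G.induce sᶜ ⊕g G.induce s)) := by
  classical
  refine ⟨RelIso.symm ⟨(Equiv.sumComm _ _).trans (Equiv.Set.sumCompl s), ?_⟩⟩
  rintro (⟨u, hu⟩ | ⟨u, hu⟩) (⟨v, hv⟩ | ⟨v, hv⟩)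
  · simp
  · simpa using fun huv => hu (h v hv u huv.symm)
  · simpa using fun huv => hv (h u hu v huv)
  · simp

variable [DecidableEq V]

theorem isMatchingWithTriangleOn_univ_iff [Fintype V] {k : ℕ}
    (hcard : Fintype.card V = 2 * k + 3) :
    IsMatchingWithTriangleOn G Finset.univ ↔
      Nonempty (G ≃g (disjointEdges k ⊕g (⊤ : SimpleGraph (Fin 3)))) := by
  constructor
  · rintro ⟨a, b, c, hT, hM⟩
    have hc := card_sdiff_triple hT.mem₁ hT.mem₂ hT.mem₃ hT.adj₁₂ hT.adj₁₃ hT.adj₂₃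
    rw [Finset.card_univ, hcard] at hc
    let T : Finset V := {c, a, b}
    have hTmem : ∀ v, v ∈ T ↔ v = c ∨ v = a ∨ v = b := fun v => by simp [T]
    have hTcard : T.card = 3 :=
      Finset.card_eq_three.2 ⟨c, a, b, hT.adj₁₃.ne', hT.adj₂₃.ne', hT.adj₁₂.ne, rfl⟩
    obtain ⟨e⟩ := nonempty_iso_sum_induce (G := G) (T : Set V) (by
      intro u hu v huv
      rw [Finset.mem_coe, hTmem] at hu ⊢
      rcases hu with rfl | rfl | rfl
      · rcases hT.nbr₃ v (Finset.mem_univ v) huv with h | h <;> simp [h]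
      · rcases hT.nbr₁ v (Finset.mem_univ v) huv with h | h <;> simp [h]
      · rcases hT.nbr₂ v (Finset.mem_univ v) huv with h | h <;> simp [h])
    obtain ⟨e₁⟩ : Nonempty (G.induce (T : Set V)ᶜ ≃g disjointEdges k) := by
      refine nonempty_iso_disjointEdges ?_ ?_
      · rw [Fintype.card_compl_set, hcard, ← Set.toFinset_card, Finset.toFinset_coe, hTcard]
        rfl
      · rintro ⟨v, hv⟩
        obtain ⟨w, hw, hvw, hN⟩ := hM v (by simpa [T] using hv)
        refine ⟨⟨w, by simpa [T] using hw⟩, hvw, ?_⟩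
        rintro ⟨z, hz⟩ hvz
        exact Subtype.ext (hN z (by simpa [T] using hz) hvz)
    obtain ⟨e₂⟩ : Nonempty (G.induce (T : Set V) ≃g (⊤ : SimpleGraph (Fin 3))) := by
      refine nonempty_iso_top (by simpa using hTcard) ?_
      rintro ⟨u, hu⟩ ⟨v, hv⟩ huv
      have huv' : u ≠ v := fun h => huv (Subtype.ext h)
      rw [Finset.mem_coe, hTmem] at hu hv
      have := hT.adj₁₂
      have := hT.adj₁₃
      have := hT.adj₂₃
      simp only [SimpleGraph.comap_adj, Function.Embedding.subtype_apply]
      rcases hu with rfl | rfl | rfl <;> rcases hv with rfl | rfl | rfl <;>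
        first | exact absurd rfl huv' | assumption | (apply SimpleGraph.Adj.symm; assumption)
    exact ⟨e.trans (SimpleGraph.Iso.sumCongr e₁ e₂)⟩
  · rintro ⟨e⟩
    have hadj : ∀ u v, G.Adj u v ↔
      (disjointEdges k ⊕g (⊤ : SimpleGraph (Fin 3))).Adj (e u) (e v) := fun u v =>
        e.map_adj_iff.symm
    have hnbr : ∀ i j l : Fin 3, i ≠ j → i ≠ l → j ≠ l → ∀ w ∈ (Finset.univ : Finset V),
        G.Adj (e.symm (.inr i)) w → w = e.symm (.inr j) ∨ w = e.symm (.inr l) := by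
      intro i j l hij hil hjl w _ h
      rw [hadj, e.apply_symm_apply] at h
      rcases hw : e w with x | x
      · rw [hw] at h; simp at h
      · rw [hw] at h
        simp only [e.eq_symm_apply, hw, Sum.inr.injEq]
        have hix : i ≠ x := by simpa using h
        omega
    have hadj3 : ∀ i j : Fin 3, i ≠ j → G.Adj (e.symm (.inr i)) (e.symm (.inr j)) := by
      intro i j hij
      rw [hadj, e.apply_symm_apply, e.apply_symm_apply]
      simpa using hij
    refine ⟨e.symm (.inr 0), e.symm (.inr 1), e.symm (.inr 2),
      ⟨Finset.mem_univ _, Finset.mem_univ _, Finset.mem_univ _, hadj3 _ _ (by decide),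
        hadj3 _ _ (by decide), hadj3 _ _ (by decide), hnbr _ _ _ (by decide) (by decide) (by decide),
        hnbr _ _ _ (by decide) (by decide) (by decide),
        hnbr _ _ _ (by decide) (by decide) (by decide)⟩, ?_⟩
    intro v hv
    obtain ⟨p, hp⟩ : ∃ p, e v = .inl p := by
      rcases hev : e v with p | i
      · exact ⟨p, rfl⟩
      · exfalso
        rw [← e.eq_symm_apply] at hev
        rw [hev] at hv
        fin_cases i <;> simp at hv
    refine ⟨e.symm (.inl (p.1, p.2 + 1)), by simp, ?_, fun z _ hz => ?_⟩
    · rw [hadj, e.apply_symm_apply, hp, SimpleGraph.sum_adj_inl]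
      exact ⟨rfl, ne_add_one_of_fin_two _⟩
    · rw [hadj, hp] at hz
      rcases hez : e z with q | i
      · rw [hez, SimpleGraph.sum_adj_inl] at hz
        rw [e.eq_symm_apply, hez]
        congr 1
        exact Prod.ext hz.1.symm (eq_add_one_of_ne_of_fin_two _ _ hz.2)
      · rw [hez] at hz
        simp at hz

end Isomorphisms

/-! ### 1-sums with a universal vertex -/

section OneSum

variable {W : Type*} {H : SimpleGraph W}

theorem IsCompleteCopy.adj {m : ℕ} {A : H.Subgraph} (hA : IsCompleteCopy m A) {u v : W}
    (hu : u ∈ A.verts) (hv : v ∈ A.verts) (huv : u ≠ v) : A.Adj u v := by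
  obtain ⟨e⟩ := hA
  have h : A.coe.Adj ⟨u, hu⟩ ⟨v, hv⟩ := by
    rw [← e.map_adj_iff, SimpleGraph.top_adj]
    exact e.injective.ne fun h => huv (congrArg Subtype.val h)
  exact h

theorem IsCompleteCopy.ncard {m : ℕ} {A : H.Subgraph} (hA : IsCompleteCopy m A) :
    A.verts.ncard = m := by
  obtain ⟨e⟩ := hA
  rw [← Nat.card_coe_set_eq, Nat.card_congr e.toEquiv, Nat.card_fin]

theorem IsCompleteCopy.nontrivial {m : ℕ} {A : H.Subgraph} (hA : IsCompleteCopy m A)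
    (hm : 2 ≤ m) : A.verts.Nontrivial := by
  have hfin : A.verts.Finite := Set.finite_of_ncard_ne_zero (by rw [hA.ncard]; omega)
  have := hA.ncard
  exact (Set.one_lt_ncard_iff_nontrivial_and_finite.1 (by omega)).1

theorem isCompleteCopy_of_injective {m : ℕ} {A : H.Subgraph} (φ : Fin m → W)
    (hφ : Function.Injective φ) (hrange : Set.range φ = A.verts)
    (hadj : ∀ i j, i ≠ j → A.Adj (φ i) (φ j)) : IsCompleteCopy m A := by
  refine ⟨RelIso.symm ⟨(Equiv.ofInjective φ hφ).trans (Equiv.setCongr hrange), fun {i j} => ?_⟩⟩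
  rw [SimpleGraph.top_adj]
  exact ⟨fun h hij => by subst hij; exact A.coe.irrefl h, fun h => hadj i j h⟩

/-- If a 1-sum has a universal vertex `r`, then `r` lies in all summands, and the neighbours
other than `r` of any other vertex are the neighbours in one summand. -/
theorem IsOneSum.mem_of_universal {S : Multiset H.Subgraph} {A : H.Subgraph} (h : IsOneSum S A)
    (hS : ∀ B ∈ S, B.verts.Nontrivial) : A.verts.Nontrivial ∧ ∀ r ∈ A.verts,
      (∀ w ∈ A.verts, w ≠ r → A.Adj r w) → (∀ B ∈ S, r ∈ B.verts) ∧
      ∀ v ∈ A.verts, v ≠ r → ∃ B ∈ S, v ∈ B.verts ∧ ∀ w, A.Adj v w ↔ B.Adj v w := by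
  induction h with
  | single A =>
    refine ⟨hS A (by simp), fun r hr _ => ⟨by simpa using hr, fun v hv _ => ⟨A, by simp, hv, ?_⟩⟩⟩
    exact fun _ => Iff.rfl
  | @glue S T A B hA hB hx ihA ihB =>
    obtain ⟨x, hx⟩ := hx
    obtain ⟨hAn, hA'⟩ := ihA fun C hC => hS C (Multiset.mem_add.2 (Or.inl hC))
    obtain ⟨hBn, hB'⟩ := ihB fun C hC => hS C (Multiset.mem_add.2 (Or.inr hC))
    have hxAB : ∀ w, w ∈ A.verts → w ∈ B.verts → w = x := fun w h1 h2 => by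
      have : w ∈ A.verts ∩ B.verts := ⟨h1, h2⟩
      simpa [hx] using this
    have hxA : x ∈ A.verts ∧ x ∈ B.verts := by
      have : x ∈ A.verts ∩ B.verts := by simp [hx]
      exact this
    refine ⟨hAn.mono (by simp), fun r hr hU => ?_⟩
    simp only [SimpleGraph.Subgraph.verts_sup, Set.mem_union, SimpleGraph.Subgraph.sup_adj]
      at hr hU ⊢
    -- The universal vertex must be the gluing vertex: otherwise it lies on one side only and misses
    -- a vertex `w ≠ x` of the other.
    obtain rfl : r = x := by
      by_contra hne
      rcases hr with hr | hr
      · obtain ⟨w, hw, hwx⟩ := hBn.exists_ne x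
        have hrB : r ∉ B.verts := fun h => hne (hxAB r hr h)
        rcases hU w (Or.inr hw) (by rintro rfl; exact hrB hw) with h | h
        · exact hwx (hxAB w h.snd_mem hw)
        · exact hrB h.fst_mem
      · obtain ⟨w, hw, hwx⟩ := hAn.exists_ne x
        have hrA : r ∉ A.verts := fun h => hne (hxAB r h hr)
        rcases hU w (Or.inl hw) (by rintro rfl; exact hrA hw) with h | h
        · exact hrA h.fst_mem
        · exact hwx (hxAB w hw h.snd_mem)
    obtain ⟨hA1, hA2⟩ := hA' r hxA.1 fun w hw hwr =>
      (hU w (Or.inl hw) hwr).resolve_right fun h => hwr (hxAB w hw h.snd_mem)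
    obtain ⟨hB1, hB2⟩ := hB' r hxA.2 fun w hw hwr =>
      (hU w (Or.inr hw) hwr).resolve_left fun h => hwr (hxAB w h.snd_mem hw)
    refine ⟨fun C hC => (Multiset.mem_add.1 hC).elim (hA1 C) (hB1 C), fun v hv hvr => ?_⟩
    rcases hv with hv | hv
    · obtain ⟨C, hC, hvC, hCadj⟩ := hA2 v hv hvr
      refine ⟨C, Multiset.mem_add.2 (Or.inl hC), hvC, fun w => ?_⟩
      rw [← hCadj]
      exact or_iff_left fun h => hvr (hxAB v hv h.fst_mem)
    · obtain ⟨C, hC, hvC, hCadj⟩ := hB2 v hv hvr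
      refine ⟨C, Multiset.mem_add.2 (Or.inr hC), hvC, fun w => ?_⟩
      rw [← hCadj]
      exact or_iff_right fun h => hvr (hxAB v h.fst_mem hv)

end OneSum

/-! ### 1-sum decompositions of suspensions -/

section Suspension

variable {V : Type*} {G : SimpleGraph V}

/-- In a 1-sum decomposition of the suspension, the apex lies in all summands and the neighbours
of any other vertex are the neighbours in one summand. -/
theorem IsOneSum.suspension {S : Multiset (suspension G).Subgraph} (h : IsOneSum S ⊤)
    (hS : ∀ B ∈ S, B.verts.Nontrivial) : (∀ B ∈ S, none ∈ B.verts) ∧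
      ∀ v : V, ∃ B ∈ S, some v ∈ B.verts ∧ ∀ w, G.Adj v w ↔ B.Adj (some v) (some w) := by
  obtain ⟨h1, h2⟩ := (h.mem_of_universal hS).2 none (by simp) (by
    rintro (_ | w) _ hw
    · exact absurd rfl hw
    · exact SimpleGraph.Subgraph.top_adj.2 trivial)
  refine ⟨h1, fun v => ?_⟩
  obtain ⟨B, hB, hvB, hadj⟩ := h2 (some v) (by simp) (by simp)
  exact ⟨B, hB, hvB, fun w => by rw [← hadj]; exact SimpleGraph.Subgraph.top_adj.symm⟩

/-- A vertex of a triangle through the apex has exactly one further neighbour there. -/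
theorem IsCompleteCopy.exists_of_three {B : (suspension G).Subgraph} (hB : IsCompleteCopy 3 B)
    (h0 : none ∈ B.verts) {v : V} (hv : some v ∈ B.verts)
    (hadj : ∀ w, G.Adj v w ↔ B.Adj (some v) (some w)) :
    ∃ w, G.Adj v w ∧ ∀ z, G.Adj v z → z = w := by
  have h1 := hB.ncard
  have hfin : B.verts.Finite := Set.finite_of_ncard_ne_zero (by omega)
  have hv' : some v ∈ B.verts \ {none} := ⟨hv, by simp⟩
  rw [← Set.ncard_sdiff_singleton_add_one h0 hfin,
    ← Set.ncard_sdiff_singleton_add_one hv' hfin.sdiff] at h1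
  obtain ⟨x, hx⟩ := Set.ncard_eq_one.1 (show ((B.verts \ {none}) \ {some v}).ncard = 1 by omega)
  have hmem : ∀ y, y ∈ (B.verts \ {none}) \ {some v} ↔ y = x := fun y => by rw [hx]; simp
  obtain ⟨⟨hxB, hx0⟩, hxv⟩ := (hmem x).2 rfl
  rcases x with _ | w
  · simp at hx0
  refine ⟨w, (hadj w).2 (hB.adj hv hxB (Ne.symm hxv)), fun z hz => ?_⟩
  have h3 := (hmem (some z)).1 ⟨⟨((hadj z).1 hz).snd_mem, by simp⟩, by simpa using hz.ne'⟩
  simpa using h3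

theorem exists_unique_nbr_of_isOneSumOfTriangles {k : ℕ}
    (h : IsOneSumOfTriangles (suspension G) k) (v : V) :
    ∃ w, G.Adj v w ∧ ∀ z, G.Adj v z → z = w := by
  obtain ⟨S, -, hS, hsum⟩ := h
  obtain ⟨h1, h2⟩ := hsum.suspension fun B hB => (hS B hB).nontrivial (by omega)
  obtain ⟨B, hB, hvB, hadj⟩ := h2 v
  exact (hS B hB).exists_of_three (h1 B hB) hvB hadj

variable {ι : Type*}

/-- The subgraph of the suspension induced by the apex and the vertices `v` with `c v ∈ s`. -/
def suspensionPart (G : SimpleGraph V) (c : V → ι) (s : Set ι) : (suspension G).Subgraph :=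
  (⊤ : (suspension G).Subgraph).induce {o | ∀ v, o = some v → c v ∈ s}

theorem none_mem_suspensionPart {c : V → ι} {s : Set ι} :
    none ∈ (suspensionPart G c s).verts := by
  intro v hv
  cases hv

theorem some_mem_suspensionPart {c : V → ι} {s : Set ι} {v : V} :
    some v ∈ (suspensionPart G c s).verts ↔ c v ∈ s :=
  ⟨fun h => h v rfl, fun h w hw => by cases hw; exact h⟩

theorem suspensionPart_adj {c : V → ι} {s : Set ι} {a b : Option V} :
    (suspensionPart G c s).Adj a b ↔ a ∈ (suspensionPart G c s).verts ∧
      b ∈ (suspensionPart G c s).verts ∧ (suspension G).Adj a b := by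
  simp only [suspensionPart, SimpleGraph.Subgraph.induce_adj, SimpleGraph.Subgraph.induce_verts,
    SimpleGraph.Subgraph.top_adj]

theorem suspensionPart_univ {c : V → ι} : suspensionPart G c Set.univ = ⊤ := by
  refine SimpleGraph.Subgraph.ext ?_ ?_
  · ext o
    simp [suspensionPart]
  · ext a b
    rw [suspensionPart_adj]
    simp [suspensionPart]

theorem suspensionPart_union {c : V → ι} (hc : ∀ u v, G.Adj u v → c u = c v) (s t : Set ι) :
    suspensionPart G c (s ∪ t) = suspensionPart G c s ⊔ suspensionPart G c t := by
  have hv : ∀ o, o ∈ (suspensionPart G c (s ∪ t)).verts ↔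
      o ∈ (suspensionPart G c s).verts ∨ o ∈ (suspensionPart G c t).verts := by
    rintro (_ | v)
    · simp [none_mem_suspensionPart]
    · simp [some_mem_suspensionPart]
  refine SimpleGraph.Subgraph.ext (Set.ext hv) ?_
  ext a b
  rw [SimpleGraph.Subgraph.sup_adj]
  simp only [suspensionPart_adj]
  rw [hv, hv]
  constructor
  · rintro ⟨ha, hb, hab⟩
    rcases a with _ | u <;> rcases b with _ | v
    · exact hab.elim
    · rcases hb with hb | hb
      exacts [Or.inl ⟨none_mem_suspensionPart, hb, hab⟩, Or.inr ⟨none_mem_suspensionPart, hb, hab⟩]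
    · rcases ha with ha | ha
      exacts [Or.inl ⟨ha, none_mem_suspensionPart, hab⟩, Or.inr ⟨ha, none_mem_suspensionPart, hab⟩]
    · simp only [some_mem_suspensionPart, hc u v hab] at ha hb ⊢
      tauto
  · tauto

/-- With a colouring that is constant on components, parts of disjoint colour sets meet only in the
apex and together contain every edge, so the parts can be glued one by one. A 1-sum has at least one
summand, hence `J` is nonempty. -/
theorem isOneSum_suspensionPart {c : V → ι} (hc : ∀ u v, G.Adj u v → c u = c v) (J : Finset ι)
    (hJ : J.Nonempty) :
    IsOneSum (J.val.map fun i => suspensionPart G c {i}) (suspensionPart G c J) := by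
  classical
  induction hJ using Finset.Nonempty.cons_induction with
  | singleton i => simpa using IsOneSum.single (suspensionPart G c {i})
  | cons i J hi hJ ih =>
    rw [Finset.cons_val, Multiset.map_cons, ← Multiset.singleton_add, Finset.coe_cons,
      Set.insert_eq, suspensionPart_union hc]
    refine IsOneSum.glue (IsOneSum.single _) ih ⟨none, Set.ext ?_⟩
    rintro (_ | v)
    · simp [none_mem_suspensionPart]
    · simp only [Set.mem_inter_iff, some_mem_suspensionPart, Set.mem_singleton_iff, reduceCtorEq,
        iff_false, not_and, Finset.mem_coe]
      rintro rfl
      exact hi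

theorem isCompleteCopy_suspensionPart {c : V → ι} {i : ι} {m : ℕ} (φ : Fin m → V)
    (hφ : Function.Injective φ) (hrange : ∀ v, c v = i ↔ ∃ j, φ j = v)
    (hadj : ∀ j l, j ≠ l → G.Adj (φ j) (φ l)) :
    IsCompleteCopy (m + 1) (suspensionPart G c {i}) := by
  have hmem : ∀ j, c (φ j) ∈ ({i} : Set ι) := fun j => (hrange _).2 ⟨j, rfl⟩
  refine isCompleteCopy_of_injective (Fin.cons none fun j => some (φ j)) ?_ ?_ ?_
  · rw [Fin.cons_injective_iff]
    exact ⟨by simp, (Option.some_injective V).comp hφ⟩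
  · rw [Fin.range_cons]
    ext (_ | v)
    · simp [none_mem_suspensionPart]
    · simp [some_mem_suspensionPart, hrange]
  · refine Fin.cases (Fin.cases (fun h => absurd rfl h) fun l _ => ?_)
      fun j => Fin.cases (fun _ => ?_) fun l hjl => ?_ <;>
      simp only [Fin.cons_zero, Fin.cons_succ, suspensionPart_adj, none_mem_suspensionPart,
        some_mem_suspensionPart, hmem, true_and]
    · trivial
    · trivial
    · exact hadj j l fun h => hjl (h ▸ rfl)

theorem isOneSumOfTriangles_of_iso {k : ℕ} (hk : 0 < k) (e : G ≃g disjointEdges k) :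
    IsOneSumOfTriangles (suspension G) k := by
  have hne : (Finset.univ : Finset (Fin k)).Nonempty := ⟨⟨0, hk⟩, Finset.mem_univ _⟩
  have hadj : ∀ u v, G.Adj u v ↔ (disjointEdges k).Adj (e u) (e v) := fun u v =>
    e.map_adj_iff.symm
  have h := isOneSum_suspensionPart (G := G) (c := fun v => (e v).1)
    (fun u v huv => ((hadj u v).1 huv).1) Finset.univ hne
  rw [Finset.coe_univ, suspensionPart_univ] at h
  refine ⟨_, by simp, fun H hH => ?_, h⟩
  obtain ⟨i, -, rfl⟩ := Multiset.mem_map.1 hH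
  refine isCompleteCopy_suspensionPart (m := 2) (fun b => e.symm (i, b)) ?_ ?_ ?_
  · intro b b' hb
    simpa using e.symm.injective hb
  · intro v
    constructor
    · rintro rfl
      exact ⟨(e v).2, e.symm_apply_apply v⟩
    · rintro ⟨b, rfl⟩
      rw [e.apply_symm_apply]
  · intro b b' hb
    rw [hadj, e.apply_symm_apply, e.apply_symm_apply]
    exact ⟨rfl, hb⟩

theorem isOneSumOfK4AndTriangles_of_iso {k : ℕ}
    (e : G ≃g (disjointEdges k ⊕g (⊤ : SimpleGraph (Fin 3)))) :
    IsOneSumOfK4AndTriangles (suspension G) k := by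
  have hadj : ∀ u v, G.Adj u v ↔
      (disjointEdges k ⊕g (⊤ : SimpleGraph (Fin 3))).Adj (e u) (e v) := fun u v =>
    e.map_adj_iff.symm
  -- The colour `none` marks the triangle, whose part is the `K_4`; the other colours index the
  -- matching edges.
  set c : V → Option (Fin k) := fun v => (e v).elim (fun p => some p.1) fun _ => none with hc
  have hcadj : ∀ u v, G.Adj u v → c u = c v := by
    intro u v huv
    rw [hadj] at huv
    simp only [hc]
    generalize e u = x at huv ⊢
    generalize e v = y at huv ⊢
    rcases x with p | i <;> rcases y with q | j <;> simp at huv ⊢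
    exact huv.1
  have h := isOneSum_suspensionPart (G := G) hcadj
    (Finset.insertNone Finset.univ) ⟨none, by simp⟩
  rw [show ((Finset.insertNone (Finset.univ : Finset (Fin k)) : Finset (Option (Fin k))) :
    Set (Option (Fin k))) = Set.univ by ext (_ | i) <;> simp, suspensionPart_univ] at h
  have hval : (Finset.insertNone (Finset.univ : Finset (Fin k))).val =
      none ::ₘ (Finset.univ : Finset (Fin k)).val.map some := rfl
  rw [hval, Multiset.map_cons, Multiset.map_map] at h
  refine ⟨_, _, ?_, by simp, fun H hH => ?_, h⟩
  · refine isCompleteCopy_suspensionPart (m := 3) (fun j => e.symm (.inr j)) ?_ ?_ ?_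
    · intro b b' hb
      simpa using e.symm.injective hb
    · intro v
      simp only [hc, e.symm_apply_eq]
      rcases e v with p | j <;> simp
    · intro b b' hb
      rw [hadj, e.apply_symm_apply, e.apply_symm_apply]
      simpa using hb
  · obtain ⟨i, -, rfl⟩ := Multiset.mem_map.1 hH
    refine isCompleteCopy_suspensionPart (m := 2) (fun b => e.symm (.inl (i, b))) ?_ ?_ ?_
    · intro b b' hb
      simpa using e.symm.injective hb
    · intro v
      simp only [hc, e.symm_apply_eq]
      rcases e v with p | j
      · simp [Prod.ext_iff, eq_comm]
      · simp
    · intro b b' hb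
      rw [hadj, e.apply_symm_apply, e.apply_symm_apply, SimpleGraph.sum_adj_inl]
      exact ⟨rfl, hb⟩

variable [Fintype V]

theorem isOneSumOfTriangles_iff {k : ℕ} (hk : 0 < k) (hcard : Fintype.card V = 2 * k) :
    IsOneSumOfTriangles (suspension G) k ↔ IsMatchingOn G Finset.univ := by
  rw [isMatchingOn_univ_iff hcard]
  exact ⟨fun h => nonempty_iso_disjointEdges hcard (exists_unique_nbr_of_isOneSumOfTriangles h),
    fun ⟨e⟩ => isOneSumOfTriangles_of_iso hk e⟩

variable [DecidableEq V]

theorem isMatchingWithTriangleOn_of_isOneSum {k : ℕ}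
    (h : IsOneSumOfK4AndTriangles (suspension G) k) :
    IsMatchingWithTriangleOn G Finset.univ := by
  obtain ⟨Q, S, hQ, -, hS, hsum⟩ := h
  have hnt : ∀ B ∈ Q ::ₘ S, B.verts.Nontrivial := by
    intro B hB
    rcases Multiset.mem_cons.1 hB with rfl | hB
    exacts [hQ.nontrivial (by omega), (hS B hB).nontrivial (by omega)]
  obtain ⟨h1, h2⟩ := hsum.suspension hnt
  have hQ0 := h1 Q (Multiset.mem_cons_self _ _)
  have hc := hQ.ncard
  rw [← Set.ncard_sdiff_singleton_add_one hQ0 (Set.finite_of_ncard_ne_zero (by omega))] at hc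
  obtain ⟨x, y, z, hxy, hxz, hyz, hxyz⟩ :=
    Set.ncard_eq_three.1 (show (Q.verts \ {none}).ncard = 3 by omega)
  have hmem : ∀ o, o ∈ Q.verts \ {none} ↔ o = x ∨ o = y ∨ o = z := fun o => by rw [hxyz]; simp
  have hx := (hmem x).2 (by simp)
  have hy := (hmem y).2 (by simp)
  have hz := (hmem z).2 (by simp)
  rcases x with _ | a
  · simp at hx
  rcases y with _ | b
  · simp at hy
  rcases z with _ | c
  · simp at hz
  have hmem' : ∀ v : V, some v ∈ Q.verts ↔ v = a ∨ v = b ∨ v = c := fun v => by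
    simpa using hmem (some v)
  have hab : G.Adj a b := (hQ.adj hx.1 hy.1 hxy).adj_sub
  have hac : G.Adj a c := (hQ.adj hx.1 hz.1 hxz).adj_sub
  have hbc : G.Adj b c := (hQ.adj hy.1 hz.1 hyz).adj_sub
  have hdich : ∀ v : V, (∃ w, G.Adj v w ∧ ∀ z, G.Adj v z → z = w) ∨
      (some v ∈ Q.verts ∧ ∀ w, G.Adj v w → some w ∈ Q.verts) := by
    intro v
    obtain ⟨B, hB, hvB, hadj⟩ := h2 v
    rcases Multiset.mem_cons.1 hB with rfl | hB'
    · exact Or.inr ⟨hvB, fun w hw => ((hadj w).1 hw).snd_mem⟩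
    · exact Or.inl ((hS B hB').exists_of_three (h1 B hB) hvB hadj)
  -- A vertex with two distinct neighbours cannot have its neighbours given by a triangle summand,
  -- so they all lie in `Q`.
  have hnbr : ∀ u v w : V, G.Adj u v → G.Adj u w → v ≠ w → ∀ t, G.Adj u t →
      t = a ∨ t = b ∨ t = c := by
    intro u v w huv huw hvw t ht
    rcases hdich u with ⟨s, -, hs⟩ | ⟨-, h⟩
    · exact absurd ((hs v huv).trans (hs w huw).symm) hvw
    · exact (hmem' t).1 (h t ht)
  have hTa : ∀ t, G.Adj a t → t = b ∨ t = c := fun t ht =>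
    (hnbr a b c hab hac hbc.ne t ht).resolve_left ht.ne'
  have hTb : ∀ t, G.Adj b t → t = a ∨ t = c := fun t ht => by
    have := hnbr b a c hab.symm hbc hac.ne t ht
    have := ht.ne'
    tauto
  have hTc : ∀ t, G.Adj c t → t = a ∨ t = b := fun t ht => by
    have := hnbr c a b hac.symm hbc.symm hab.ne t ht
    have := ht.ne'
    tauto
  refine ⟨a, b, c, ⟨Finset.mem_univ _, Finset.mem_univ _, Finset.mem_univ _, hab, hac, hbc,
    fun t _ => hTa t, fun t _ => hTb t, fun t _ => hTc t⟩, fun v hv => ?_⟩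
  simp only [Finset.mem_sdiff, Finset.mem_univ, true_and, Finset.mem_insert,
    Finset.mem_singleton, not_or] at hv
  rcases hdich v with ⟨w, hvw, hw⟩ | ⟨hvQ, -⟩
  · refine ⟨w, ?_, hvw, fun z _ hz => hw z hz⟩
    simp only [Finset.mem_sdiff, Finset.mem_univ, true_and, Finset.mem_insert,
      Finset.mem_singleton, not_or]
    refine ⟨?_, ?_, ?_⟩
    · rintro rfl
      rcases hTc v hvw.symm with h | h
      exacts [hv.2.1 h, hv.2.2 h]
    · rintro rfl
      rcases hTa v hvw.symm with h | h
      exacts [hv.2.2 h, hv.1 h]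
    · rintro rfl
      rcases hTb v hvw.symm with h | h
      exacts [hv.2.1 h, hv.1 h]
  · have := (hmem' v).1 hvQ
    tauto

theorem isOneSumOfK4AndTriangles_iff {k : ℕ} (hcard : Fintype.card V = 2 * k + 3) :
    IsOneSumOfK4AndTriangles (suspension G) k ↔ IsMatchingWithTriangleOn G Finset.univ := by
  refine ⟨isMatchingWithTriangleOn_of_isOneSum, fun h => ?_⟩
  obtain ⟨e⟩ := (isMatchingWithTriangleOn_univ_iff hcard).1 h
  exact isOneSumOfK4AndTriangles_of_iso e

end Suspension

/-! ### Assembling the bounds and the Braun–Bruegge conjecture -/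

section BraunBruegge

variable {V : Type*} {G : SimpleGraph V}

theorem suspension_adj_none {o : Option V} : (suspension G).Adj none o ↔ o ≠ none := by
  cases o with
  | none => exact ⟨False.elim, fun h => absurd rfl h⟩
  | some v => exact ⟨fun _ => by simp, fun _ => trivial⟩

/-- A complete bipartite graph that is isomorphic to a suspension is a star. -/
theorem eq_one_of_suspension_iso {a b : ℕ} (e : suspension G ≃g
    completeBipartiteGraph (Fin a) (Fin b)) : a = 1 ∨ b = 1 := by
  have hU : ∀ x, x ≠ e none → (completeBipartiteGraph (Fin a) (Fin b)).Adj (e none) x := by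
    intro x hx
    rw [← e.apply_symm_apply x, e.map_adj_iff, suspension_adj_none]
    rintro h
    rw [← h, e.apply_symm_apply] at hx
    exact hx rfl
  rcases h : e none with i | i
  · left
    have hi : ∀ j, j = i := fun j => by
      by_contra hj
      have := hU (Sum.inl j) (by simpa [h] using hj)
      simp [h] at this
    have : Subsingleton (Fin a) := ⟨fun x y => (hi x).trans (hi y).symm⟩
    have := i.pos
    have := Fin.subsingleton_iff_le_one.1 ‹_›
    omega
  · right
    have hi : ∀ j, j = i := fun j => by
      by_contra hj
      have := hU (Sum.inr j) (by simpa [h] using hj)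
      simp [h] at this
    have : Subsingleton (Fin b) := ⟨fun x y => (hi x).trans (hi y).symm⟩
    have := i.pos
    have := Fin.subsingleton_iff_le_one.1 ‹_›
    omega

theorem eq_bot_iff_nonempty_suspension_iso_star [Fintype V] {m : ℕ} (hm : Fintype.card V = m) :
    G = ⊥ ↔ Nonempty (suspension G ≃g completeBipartiteGraph (Fin 1) (Fin m)) := by
  constructor
  · rintro rfl
    refine ⟨⟨(Equiv.optionEquivSumPUnit.{0} V).trans ((Equiv.sumComm _ _).trans
      (Equiv.sumCongr (Equiv.ofUnique _ _) (Fintype.equivFinOfCardEq hm))), ?_⟩⟩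
    rintro (_ | u) (_ | v)
    · simp
    · simp [suspension_adj_none]
    · simp [SimpleGraph.adj_comm _ (some u) none, suspension_adj_none]
    · simp [suspension]
  · rintro ⟨e⟩
    by_contra hne
    obtain ⟨u, v, huv⟩ := SimpleGraph.ne_bot_iff_exists_adj.1 hne
    have h1 : (suspension G).Adj none (some u) := trivial
    have h2 : (suspension G).Adj none (some v) := trivial
    have h3 : (suspension G).Adj (some u) (some v) := huv
    rw [← e.map_adj_iff] at h1 h2 h3
    generalize e none = x at h1 h2
    generalize e (some u) = y at h1 h3
    generalize e (some v) = z at h2 h3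
    rcases x with x | x <;> rcases y with y | y <;> rcases z with z | z <;>
      simp at h1 h2 h3

variable [Fintype V] [DecidableEq V]

/-- The parity is that of the vertex set of `G`, opposite to the parity of `n`. -/
theorem numFacets_suspension_of_even {k : ℕ} (hk : 0 < k) (hcard : Fintype.card V = 2 * k) :
    numFacets (suspension G) ≤ 6 ^ k ∧
      (numFacets (suspension G) = 6 ^ k ↔ IsMatchingOn G Finset.univ) := by
  have : Nonempty V := Fintype.card_pos_iff.1 (by omega)
  have h1 := six_mul_card_labelings_le G Finset.univ
  have h2 := card_labelings_eq_iff_of_even (G := G) (Y := Finset.univ)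
    (by rw [Finset.card_univ, hcard]; exact even_two_mul k)
  rw [← numFacets_suspension, Finset.card_univ, hcard, labelingBound_even, pow_succ] at h1 h2
  rw [← h2]
  omega

theorem numFacets_suspension_of_odd {k : ℕ} (hcard : Fintype.card V = 2 * k + 1) :
    6 * numFacets (suspension G) ≤ 14 * 6 ^ k ∧
      (6 * numFacets (suspension G) = 14 * 6 ^ k ↔ IsMatchingWithTriangleOn G Finset.univ) := by
  have : Nonempty V := Fintype.card_pos_iff.1 (by omega)
  have h1 := six_mul_card_labelings_le G Finset.univ
  have h2 := card_labelings_eq_iff_of_odd (G := G) (Y := Finset.univ)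
    (by rw [Finset.card_univ, hcard]; exact odd_two_mul_add_one k)
  rw [← numFacets_suspension, Finset.card_univ, hcard, labelingBound_odd] at h1 h2
  exact ⟨h1, h2⟩

theorem three_le_card_of_isMatchingWithTriangleOn (h : IsMatchingWithTriangleOn G Finset.univ) :
    3 ≤ Fintype.card V := by
  obtain ⟨a, b, c, hT, -⟩ := h
  have := card_sdiff_triple hT.mem₁ hT.mem₂ hT.mem₃ hT.adj₁₂ hT.adj₁₃ hT.adj₂₃
  rw [Finset.card_univ] at this
  omega

theorem numFacets_suspension_lower [Nonempty V] :
    2 ^ Fintype.card V ≤ numFacets (suspension G) ∧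
      (numFacets (suspension G) = 2 ^ Fintype.card V ↔ G = ⊥) := by
  rw [numFacets_suspension]
  exact ⟨two_pow_le_card_labelings G, card_labelings_eq_two_pow_iff⟩

theorem numFacets_suspension_upper_of_odd {n : ℕ} (hn : 2 ≤ n) (hV : Fintype.card V = n - 1)
    (hodd : Odd n) :
    (numFacets (suspension G) : ℝ) ≤ (6 : ℝ) ^ (((n : ℝ) - 1) / 2) ∧
      ((numFacets (suspension G) : ℝ) = (6 : ℝ) ^ (((n : ℝ) - 1) / 2) ↔
        Nonempty (G ≃g disjointEdges ((n - 1) / 2))) ∧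
      ((numFacets (suspension G) : ℝ) = (6 : ℝ) ^ (((n : ℝ) - 1) / 2) ↔
        IsOneSumOfTriangles (suspension G) ((n - 1) / 2)) := by
  obtain ⟨k, rfl⟩ := hodd
  have hcard : Fintype.card V = 2 * k := by omega
  have hk : 0 < k := by omega
  have hexp : (6 : ℝ) ^ ((((2 * k + 1 : ℕ) : ℝ) - 1) / 2) = ((6 ^ k : ℕ) : ℝ) := by
    rw [show (((2 * k + 1 : ℕ) : ℝ) - 1) / 2 = (k : ℝ) by push_cast; ring, Real.rpow_natCast]
    push_cast
    rfl
  obtain ⟨h1, h2⟩ := numFacets_suspension_of_even (G := G) hk hcard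
  rw [hexp, Nat.cast_le, Nat.cast_inj, h2, show (2 * k + 1 - 1) / 2 = k by omega]
  exact ⟨h1, isMatchingOn_univ_iff hcard, (isOneSumOfTriangles_iff hk hcard).symm⟩

theorem numFacets_suspension_upper_of_even {n : ℕ} (hn : 2 ≤ n) (hV : Fintype.card V = n - 1)
    (heven : Even n) :
    (numFacets (suspension G) : ℝ) ≤ 14 * (6 : ℝ) ^ ((n : ℝ) / 2 - 2) ∧
      ((numFacets (suspension G) : ℝ) = 14 * (6 : ℝ) ^ ((n : ℝ) / 2 - 2) ↔
        4 ≤ n ∧ Nonempty (G ≃g (disjointEdges (n / 2 - 2) ⊕g (⊤ : SimpleGraph (Fin 3))))) ∧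
      ((numFacets (suspension G) : ℝ) = 14 * (6 : ℝ) ^ ((n : ℝ) / 2 - 2) ↔
        4 ≤ n ∧ IsOneSumOfK4AndTriangles (suspension G) (n / 2 - 2)) := by
  obtain ⟨k, hk⟩ : ∃ k, n = 2 * k + 2 := by
    obtain ⟨j, hj⟩ := heven
    exact ⟨j - 1, by omega⟩
  subst hk
  have hcard : Fintype.card V = 2 * k + 1 := by omega
  -- The exponent equals k - 1 and is -1 when n = 2, so the bound is kept as a real quotient by 6.
  -- In the graphs below, the truncated `k - 1` is harmless because equality forces `4 ≤ n`.
  have hexp : 14 * (6 : ℝ) ^ (((2 * k + 2 : ℕ) : ℝ) / 2 - 2) = ((14 * 6 ^ k : ℕ) : ℝ) / 6 := by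
    rw [show ((2 * k + 2 : ℕ) : ℝ) / 2 - 2 = (k : ℝ) - 1 by push_cast; ring,
      Real.rpow_sub_one (by norm_num), Real.rpow_natCast]
    push_cast
    ring
  obtain ⟨h1, h2⟩ := numFacets_suspension_of_odd (G := G) hcard
  have hle : (numFacets (suspension G) : ℝ) ≤ ((14 * 6 ^ k : ℕ) : ℝ) / 6 := by
    rw [le_div_iff₀ (by norm_num), mul_comm]
    exact_mod_cast h1
  have heq : (numFacets (suspension G) : ℝ) = ((14 * 6 ^ k : ℕ) : ℝ) / 6 ↔
      IsMatchingWithTriangleOn G Finset.univ := by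
    rw [eq_div_iff (by norm_num), mul_comm, ← h2]
    exact_mod_cast Iff.rfl
  rw [hexp, heq, show (2 * k + 2) / 2 - 2 = k - 1 by omega]
  refine ⟨hle, ?_, ?_⟩
  · constructor
    · intro h
      have := three_le_card_of_isMatchingWithTriangleOn h
      exact ⟨by omega, (isMatchingWithTriangleOn_univ_iff (k := k - 1) (by omega)).1 h⟩
    · rintro ⟨h4, h⟩
      exact (isMatchingWithTriangleOn_univ_iff (k := k - 1) (by omega)).2 h
  · constructor
    · intro h
      have := three_le_card_of_isMatchingWithTriangleOn h
      exact ⟨by omega, (isOneSumOfK4AndTriangles_iff (k := k - 1) (by omega)).2 h⟩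
    · rintro ⟨h4, h⟩
      exact (isOneSumOfK4AndTriangles_iff (k := k - 1) (by omega)).1 h

theorem satisfiesBraunBruegge_suspension {n : ℕ} (hn : 3 ≤ n) (hV : Fintype.card V = n - 1) :
    SatisfiesBraunBruegge (suspension G) := by
  have : Nonempty V := Fintype.card_pos_iff.1 (by omega)
  have hcard : Fintype.card (Option V) = n := by rw [Fintype.card_option]; omega
  obtain ⟨hlow, hlow'⟩ := numFacets_suspension_lower (G := G)
  unfold SatisfiesBraunBruegge
  simp only [hcard]
  refine ⟨fun hodd => ?_, fun heven => ?_⟩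
  · obtain ⟨h1, -, h2⟩ := numFacets_suspension_upper_of_odd (G := G) (by omega) hV hodd
    obtain ⟨k, rfl⟩ := hodd
    have hk : 1 ≤ k := by omega
    have hV' : Fintype.card V = 2 * k := by omega
    have hexp : (2 : ℝ) ^ ((((2 * k + 1 : ℕ) : ℝ) - 1) / 2) = (2 : ℝ) ^ k := by
      rw [show (((2 * k + 1 : ℕ) : ℝ) - 1) / 2 = (k : ℝ) by push_cast; ring, Real.rpow_natCast]
    have hN : ((2 : ℝ) ^ k) ^ 2 ≤ numFacets (suspension G) := by
      rw [← pow_mul, mul_comm, ← hV']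
      exact_mod_cast hlow
    have h2k : (2 : ℝ) ≤ 2 ^ k := by
      calc (2 : ℝ) = 2 ^ 1 := by norm_num
        _ ≤ 2 ^ k := pow_le_pow_right₀ (by norm_num) hk
    -- With x = 2^k ≥ 2, the claim is x² - 3x + 2 = (x - 1)(x - 2) ≥ 0. Equality needs k = 1, that
    -- is n = 3, where the bipartite graph is a star.
    refine ⟨by rw [hexp]; nlinarith, h1, ?_, h2⟩
    rw [hexp, show (Fintype.card (Option V) - 1) / 2 = k by omega,
      show (Fintype.card (Option V) + 1) / 2 = k + 1 by omega]
    have hiff : k = 1 → ((numFacets (suspension G) : ℝ) = 3 * 2 ^ k - 2 ↔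
        Nonempty (suspension G ≃g completeBipartiteGraph (Fin k) (Fin (k + 1)))) := by
      rintro rfl
      rw [← eq_bot_iff_nonempty_suspension_iso_star (show Fintype.card V = 1 + 1 by omega),
        ← hlow', hV', show (3 : ℝ) * 2 ^ 1 - 2 = ((2 ^ (2 * 1) : ℕ) : ℝ) by norm_num,
        Nat.cast_inj]
    constructor
    · intro h
      refine (hiff ?_).1 h
      by_contra hk1
      have h4 : (4 : ℝ) ≤ 2 ^ k := by
        calc (4 : ℝ) = 2 ^ 2 := by norm_num
          _ ≤ 2 ^ k := pow_le_pow_right₀ (by norm_num) (by omega)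
      nlinarith
    · intro h
      refine (hiff ?_).2 h
      obtain ⟨e⟩ := h
      rcases eq_one_of_suspension_iso e with h | h <;> omega
  · obtain ⟨h1, -, h2⟩ := numFacets_suspension_upper_of_even (G := G) (by omega) hV heven
    obtain ⟨k, hk⟩ : ∃ k, n = 2 * k + 2 := by
      obtain ⟨j, hj⟩ := heven
      exact ⟨j - 1, by omega⟩
    subst hk
    have hk : 1 ≤ k := by omega
    have hV' : Fintype.card V = 2 * k + 1 := by omega
    have hexp : (2 : ℝ) ^ (((2 * k + 2 : ℕ) : ℝ) / 2 + 1) = 4 * (2 : ℝ) ^ k := by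
      rw [show ((2 * k + 2 : ℕ) : ℝ) / 2 + 1 = ((k + 2 : ℕ) : ℝ) by push_cast; ring,
        Real.rpow_natCast]
      ring
    have hN : 2 * ((2 : ℝ) ^ k) ^ 2 ≤ numFacets (suspension G) := by
      rw [← pow_mul, mul_comm k, ← pow_succ', ← hV']
      exact_mod_cast hlow
    have h2k : (2 : ℝ) ≤ 2 ^ k := by
      calc (2 : ℝ) = 2 ^ 1 := by norm_num
        _ ≤ 2 ^ k := pow_le_pow_right₀ (by norm_num) hk
    -- With x = 2^k this is 2(x - 1)² > 0, so equality is impossible; accordingly no suspension is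
    -- the balanced complete bipartite graph.
    have hlt : 4 * (2 : ℝ) ^ k - 2 < numFacets (suspension G) := by nlinarith
    rw [hexp]
    refine ⟨hlt.le, h1, ⟨fun h => absurd h hlt.ne', ?_⟩, h2.trans (and_iff_right (by omega))⟩
    rintro ⟨e⟩
    rcases eq_one_of_suspension_iso e with h | h <;> omega

end BraunBruegge

theorem theorem1p3 {V : Type*} [Fintype V] [DecidableEq V] (n : ℕ) (hn : 2 ≤ n)
    (hV : Fintype.card V = n - 1) (G : SimpleGraph V) :
    -- the lower bound and its equality case
    (2 ^ (n - 1) ≤ numFacets (suspension G) ∧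
      (numFacets (suspension G) = 2 ^ (n - 1) ↔ G = ⊥) ∧
      (numFacets (suspension G) = 2 ^ (n - 1) ↔
        Nonempty (suspension G ≃g completeBipartiteGraph (Fin 1) (Fin (n - 1))))) ∧
    -- the upper bound and its equality case for odd `n`
    (Odd n →
      (numFacets (suspension G) : ℝ) ≤ (6 : ℝ) ^ (((n : ℝ) - 1) / 2) ∧
      ((numFacets (suspension G) : ℝ) = (6 : ℝ) ^ (((n : ℝ) - 1) / 2) ↔
        Nonempty (G ≃g disjointEdges ((n - 1) / 2))) ∧
      ((numFacets (suspension G) : ℝ) = (6 : ℝ) ^ (((n : ℝ) - 1) / 2) ↔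
        IsOneSumOfTriangles (suspension G) ((n - 1) / 2))) ∧
    -- the upper bound and its equality case for even `n`; equality forces `4 ≤ n`
    (Even n →
      (numFacets (suspension G) : ℝ) ≤ 14 * (6 : ℝ) ^ ((n : ℝ) / 2 - 2) ∧
      ((numFacets (suspension G) : ℝ) = 14 * (6 : ℝ) ^ ((n : ℝ) / 2 - 2) ↔
        4 ≤ n ∧ Nonempty (G ≃g (disjointEdges (n / 2 - 2) ⊕g (⊤ : SimpleGraph (Fin 3))))) ∧
      ((numFacets (suspension G) : ℝ) = 14 * (6 : ℝ) ^ ((n : ℝ) / 2 - 2) ↔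
        4 ≤ n ∧ IsOneSumOfK4AndTriangles (suspension G) (n / 2 - 2))) ∧
    -- the Braun–Bruegge conjecture holds for suspension graphs
    (3 ≤ n → SatisfiesBraunBruegge (suspension G)) := by
  have : Nonempty V := Fintype.card_pos_iff.1 (by omega)
  obtain ⟨h1, h2⟩ := numFacets_suspension_lower (G := G)
  rw [hV] at h1 h2
  exact ⟨⟨h1, h2, h2.trans (eq_bot_iff_nonempty_suspension_iso_star hV)⟩,
    numFacets_suspension_upper_of_odd hn hV, numFacets_suspension_upper_of_even hn hV,
    fun hn3 => satisfiesBraunBruegge_suspension hn3 hV⟩
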